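/- Let $\mathcal X$ be a finite set of colours and let $c\in\mathbb Z$. For each $n$ consider a Pólya–Eggenberger urn that initially holds $\alpha_i(n)\ge 1$ balls of colour $i\in\mathcal X$, where $-nc\le\min_i\alpha_i(n)$. A ball is drawn uniformly at random and returned together with $c$ balls of the same colour, and this is repeated $n$ times; let $X_1,\dots,X_n$ be the colours drawn and let $\nu^n$ be their type (the vector of relative frequencies). Put $N(n)=\sum_i\alpha_i(n)$, $q_i(n)=\alpha_i(n)/N(n)$ and $\beta(n)=n/N(n)$, and assume that $q(n)\to q$ and $\beta(n)\to\beta\in(0,1)$ as $n\to\infty$. With $I(a\|b)=\sum_i a_i\log\frac{a_i}{b_i}$ (where $0\log\frac{0}{b}=0$, and $a\log\frac a0=\infty$ for $a>0$), the Pólya divergence of a probability vector $p$ from $q$ is $$I(p\|q;\beta,c)=I(p\|q+\beta cp)+\frac1{\beta c}I(q\|q+\beta cp)+\frac{1+\beta c}{\beta c}\log(1+\beta c)\quad(c\ne0),\qquad I(p\|q;\beta,0)=I(p\|q),$$ where, if $q_i+\beta c p_i=0<p_i$ for some $i$, the two contributions of $i$ (formally $\infty-\infty$) are replaced by the limit of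 their sum, $-p_i\log(-\beta c)$. Let $\Pi$ be a convex, closed set of probability vectors on $\mathcal X$, and let $\hat p=\hat p(\beta,c)$ be the Pólya $I$-projection of $q$ on $\Pi$, that is, a minimizer of $I(p\|q;\beta,c)$ over $p\in\Pi$; if $q_i=0$ for some $i$, assume that it is the only minimizer. Assume that $\hat p$ is a limit of types (of sequences of any lengths) that lie in $\Pi$; this holds, for example, if $\Pi$ has non-empty interior relative to the probability simplex, or if $\Pi$ is given by finitely many linear equations and inequalities with rational coefficients. Then the event $\nu^n\in\Pi$ has positive probability for infinitely many $n$, and for every fixed $t$ and all $x_1,\dots,x_t\in\mathcal X$, $$\lim_{n\to\infty}\Pr(X_1=x_1,\dots,X_t=x_t\mid\nu^n\in\Pi)=\prod_{l=1}^t\hat p_{x_l}(\beta,c),$$ the limit being taken along those $n$ for which the event $\nu^n\in\Pi$ has positive probability. -/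

import Mathlib

open Filter Topology

noncomputable section

namespace Polya

variable {X : Type*} [Fintype X]

/-- Total number of balls in an urn holding `α i` balls of colour `i`. -/
def total (α : X → ℕ) : ℕ := ∑ i, α i

open Classical in
/-- Number of times the colour `i` occurs in the sequence of draws `w`. -/
def count {n : ℕ} (w : Fin n → X) (i : X) : ℕ :=
  (Finset.univ.filter fun l => w l = i).card

open Classical in
/-- Number of draws strictly before draw `l` that have the same colour as draw `l`. -/
def prior {n : ℕ} (w : Fin n → X) (l : Fin n) : ℕ :=
  (Finset.univ.filter fun j => j < l ∧ w j = w l).card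

/-- Probability that the first `n` draws from the urn are `w 0, …, w (n - 1)`, when each drawn ball
is returned together with `c` balls of its colour: the product over `l` of the current proportion
of balls of colour `w l`. -/
def seqProb (α : X → ℕ) (c : ℤ) {n : ℕ} (w : Fin n → X) : ℝ :=
  ∏ l : Fin n, ((α (w l) : ℝ) + (c : ℝ) * (prior w l : ℝ)) /
    ((total α : ℝ) + (c : ℝ) * ((l : ℕ) : ℝ))

open Classical in
/-- Probability of an event about the first `n` draws. -/
def prob (α : X → ℕ) (c : ℤ) {n : ℕ} (E : Set (Fin n → X)) : ℝ :=
  ∑ w : Fin n → X, if w ∈ E then seqProb α c w else 0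

/-- Conditional probability of `A` given `B`; meaningful when `prob α c B ≠ 0`. -/
def condProb (α : X → ℕ) (c : ℤ) {n : ℕ} (A B : Set (Fin n → X)) : ℝ :=
  prob α c (A ∩ B) / prob α c B

/-- The type (empirical distribution) of a sequence of `n` draws. -/
def empType {n : ℕ} (w : Fin n → X) : X → ℝ := fun i => (count w i : ℝ) / (n : ℝ)

/-- The event that the type of the first `n` draws lies in `S`. -/
def typeEvent (n : ℕ) (S : Set (X → ℝ)) : Set (Fin n → X) := {w | empType w ∈ S}

/-- The event, about the first `n` draws, that `n ≥ t` and the first `t` draws are `x`. -/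
def prefixEvent (n : ℕ) {t : ℕ} (x : Fin t → X) : Set (Fin n → X) :=
  {w | ∃ h : t ≤ n, ∀ l : Fin t, w (Fin.castLE h l) = x l}

/-- The `n`-types that lie in `S`. -/
def typesIn (n : ℕ) (S : Set (X → ℝ)) : Set (X → ℝ) :=
  {p | p ∈ S ∧ ∃ w : Fin n → X, empType w = p}

/-- `a log (a / b)` for `a, b ≥ 0`, with `0 log (0 / b) = 0` and `a log (a / 0) = ∞` for `a > 0`. -/
def klTerm (a b : ℝ) : EReal :=
  if a = 0 then 0 else if b = 0 then ⊤ else ((a * Real.log (a / b) : ℝ) : EReal)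

/-- Kullback-Leibler divergence of nonnegative vectors. -/
def kl (p q : X → ℝ) : EReal := ∑ i, klTerm (p i) (q i)

/-- The contribution of one colour, with `x = p i`, `y = q i` and `b = β c ≠ 0`, to
`I(p ‖ q + b p) + (1 / b) I(q ‖ q + b p)`.  At `y + b x = 0` with `x > 0` (possible only for
`b < 0`) the two summands are `∞` and `-∞`, and the value is the limit of their sum. -/
def polyaTerm (b x y : ℝ) : ℝ :=
  if y + b * x = 0 then -(x * Real.log (-b))
  else x * Real.log (x / (y + b * x)) + 1 / b * (y * Real.log (y / (y + b * x)))

/-- The Polya divergence `I(p ‖ q; β, c)`, for `β > 0`, probability vectors `p`, `q` with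
`q + β c p ≥ 0`:
`I(p ‖ q + β c p) + (1 / (β c)) I(q ‖ q + β c p) + ((1 + β c) / (β c)) log (1 + β c)` if `c ≠ 0`,
and the Kullback-Leibler divergence if `c = 0`. -/
def divergence (β : ℝ) (c : ℤ) (p q : X → ℝ) : EReal :=
  if c = 0 then kl p q
  else ((∑ i, polyaTerm (β * c) (p i) (q i) +
    (1 + β * c) / (β * c) * Real.log (1 + β * c) : ℝ) : EReal)

/-- `r` minimizes the Polya divergence from `q` over `S`. -/
def IsProjection (S : Set (X → ℝ)) (β : ℝ) (c : ℤ) (q r : X → ℝ) : Prop :=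
  r ∈ S ∧ ∀ p ∈ S, divergence β c r q ≤ divergence β c p q

end Polya

end

set_option linter.unusedSectionVars false

noncomputable section

namespace Polya

variable {X : Type*} [Fintype X]

/-! The draws are exchangeable: the factors of the probability of a sequence, grouped by colour, run
through arithmetic progressions, so only the counts matter (`seqProb_eq`). Given the counts `k`, all
sequences are therefore equally likely and the first `t` draws are draws without replacement. Their
conditional probability is `prefixRatio`, a quotient of falling factorials that tends to `∏ p (x l)`
when `k / n → p`. The required conditional probability is thus an average of `prefixRatio` over the
types in `S` (`condProb_eq`), and it suffices that the weights concentrate at the projection.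

Up to a factor common to all types, a weight is `exp (n * rate)`. The rate is a difference of sums
of logarithms along arithmetic progressions, which convexity of `x log x - x` compares with
integrals; its limit is minus the divergence, up to a constant. Uniqueness of the minimizer and
compactness of `S` minus a neighbourhood of it give a uniform gap `δ` between the rates of far types
and that of a reference type (`UrnLimit.exists_gap`). There are at most `(n + 1) ^ |X|` types, so
the factor `exp (-n δ)` makes the far ones negligible.

The reference type must lie in `S` and exist for every large `n` for which `S` contains any
`n`-type. `exists_typeVecs_near` builds one at distance `O(1 / n)` from the projection by rounding
inside the cone over `S`. This precision matters if `c = 0` and `q i = 0`: a draw of colour `i` then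
costs up to `log N`, which is affordable only for a bounded number of draws. -/

/-! ### Exchangeability of the draws. -/

theorem count_eq_sum [DecidableEq X] {n : ℕ} (w : Fin n → X) (i : X) :
    count w i = ∑ l, if w l = i then 1 else 0 := by
  rw [count, Finset.card_filter]
  exact Finset.sum_congr rfl fun l _ => by congr

theorem prior_eq_sum [DecidableEq X] {n : ℕ} (w : Fin n → X) (l : Fin n) :
    prior w l = ∑ j, if j < l ∧ w j = w l then 1 else 0 := by
  rw [prior, Finset.card_filter]
  exact Finset.sum_congr rfl fun l _ => by congr

theorem sum_count {n : ℕ} (w : Fin n → X) : ∑ i, count w i = n := by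
  classical
  simp_rw [count_eq_sum]
  rw [Finset.sum_comm]
  simp

theorem count_succ [DecidableEq X] {n : ℕ} (w : Fin (n + 1) → X) (i : X) :
    count w i = count (fun l : Fin n => w l.castSucc) i + if w (Fin.last n) = i then 1 else 0 := by
  simp_rw [count_eq_sum]
  rw [Fin.sum_univ_castSucc]

theorem prior_castSucc {n : ℕ} (w : Fin (n + 1) → X) (l : Fin n) :
    prior w l.castSucc = prior (fun l : Fin n => w l.castSucc) l := by
  classical
  simp_rw [prior_eq_sum]
  rw [Fin.sum_univ_castSucc]
  have : ¬ Fin.last n < l.castSucc := by simp [Fin.le_last]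
  simp [this]

theorem prior_last {n : ℕ} (w : Fin (n + 1) → X) :
    prior w (Fin.last n) = count (fun l : Fin n => w l.castSucc) (w (Fin.last n)) := by
  classical
  simp_rw [prior_eq_sum, count_eq_sum]
  rw [Fin.sum_univ_castSucc]
  simp [Fin.castSucc_lt_last]

/-- The product of the first `k` terms of the arithmetic progression `a, a + c, …`. -/
def risingProd (a c : ℝ) (k : ℕ) : ℝ := ∏ j ∈ Finset.range k, (a + c * j)

/-- The successive draws of colour `i` contribute the successive terms of the progression `α i, α i
+ c, …`, wherever they occur. Induction on the last draw. -/
theorem prod_prior_eq (α : X → ℕ) (c : ℤ) {n : ℕ} (w : Fin n → X) :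
    ∏ l : Fin n, ((α (w l) : ℝ) + (c : ℝ) * (prior w l : ℝ)) =
      ∏ i, risingProd (α i) c (count w i) := by
  classical
  induction n with
  | zero => simp [count, risingProd]
  | succ n ih =>
    rw [Fin.prod_univ_castSucc]
    simp_rw [prior_castSucc, prior_last]
    rw [ih (fun l => w l.castSucc)]
    have h : ∀ i, risingProd (α i) c (count w i) =
        risingProd (α i) c (count (fun l : Fin n => w l.castSucc) i) *
          if w (Fin.last n) = i then
            ((α i : ℝ) + c * (count (fun l : Fin n => w l.castSucc) i : ℝ)) else 1 := by
      intro i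
      rw [count_succ]
      split_ifs
      · rw [risingProd, Finset.prod_range_succ, risingProd]
      · simp
    simp_rw [h]
    rw [Finset.prod_mul_distrib]
    simp

theorem seqProb_eq (α : X → ℕ) (c : ℤ) {n : ℕ} (w : Fin n → X) :
    seqProb α c w = (∏ i, risingProd (α i) c (count w i)) / risingProd (total α) c n := by
  rw [seqProb, Finset.prod_div_distrib, prod_prior_eq,
    risingProd.eq_def (total α : ℝ), Finset.prod_range]

/-! ### Counting sequences with given counts and prefix. -/

open Classical in
/-- The number of sequences of length `n` with the vector of counts `k`. -/
def typeCard (n : ℕ) (k : X → ℕ) : ℕ :=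
  (Finset.univ.filter fun w : Fin n → X => count w = k).card

open Classical in
/-- The number of sequences of length `n` with prefix `x` and vector of counts `k`. -/
def prefixCard (n : ℕ) {t : ℕ} (x : Fin t → X) (k : X → ℕ) : ℕ :=
  (Finset.univ.filter fun w : Fin n → X => w ∈ prefixEvent n x ∧ count w = k).card

theorem count_append {t m : ℕ} (u : Fin t → X) (v : Fin m → X) (i : X) :
    count (Fin.append u v) i = count u i + count v i := by
  classical
  simp_rw [count_eq_sum]
  rw [Fin.sum_univ_add]
  simp

/-- Deleting the fixed prefix is a bijection onto the sequences with the remaining counts. -/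
theorem prefixCard_add {t : ℕ} (m : ℕ) (x : Fin t → X) (k : X → ℕ) :
    prefixCard (t + m) x (count x + k) = typeCard m k := by
  classical
  rw [prefixCard, typeCard]
  symm
  refine Finset.card_bij (fun v _ => Fin.append x v) ?_ ?_ ?_
  · intro v hv
    simp only [Finset.mem_filter, Finset.mem_univ, true_and] at hv ⊢
    refine ⟨⟨Nat.le_add_right _ _, fun l => Fin.append_left x v l⟩, ?_⟩
    ext i
    rw [count_append, ← hv, Pi.add_apply]
  · intro v _ v' _ h
    funext l
    have := congrFun h (Fin.natAdd t l)
    simpa using this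
  · intro w hw
    simp only [Finset.mem_filter, Finset.mem_univ, true_and] at hw
    obtain ⟨⟨h, hx⟩, hk⟩ := hw
    have happ : Fin.append x (fun l : Fin m => w (Fin.natAdd t l)) = w := by
      funext l
      refine Fin.addCases (fun l => ?_) (fun l => ?_) l
      · rw [Fin.append_left, ← hx l]; rfl
      · rw [Fin.append_right]
    refine ⟨fun l => w (Fin.natAdd t l), ?_, happ⟩
    simp only [Finset.mem_filter, Finset.mem_univ, true_and]
    ext i
    have h1 := congrFun hk i
    rw [← happ, count_append, Pi.add_apply] at h1
    omega

theorem prefixCard_eq_zero {n t : ℕ} (x : Fin t → X) (k : X → ℕ) (i : X)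
    (h : k i < count x i) : prefixCard n x k = 0 := by
  classical
  rw [prefixCard, Finset.card_eq_zero, Finset.filter_eq_empty_iff]
  rintro w - ⟨⟨ht, hx⟩, rfl⟩
  obtain ⟨m, rfl⟩ := Nat.exists_eq_add_of_le ht
  have happ : Fin.append x (fun l : Fin m => w (Fin.natAdd t l)) = w := by
    funext l
    refine Fin.addCases (fun l => ?_) (fun l => ?_) l
    · rw [Fin.append_left, ← hx l]; rfl
    · rw [Fin.append_right]
  rw [← happ, count_append] at h
  omega

theorem typeCard_succ [DecidableEq X] (n : ℕ) (k : X → ℕ) :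
    typeCard (n + 1) k = ∑ i, if 0 < k i then typeCard n (Function.update k i (k i - 1)) else 0 := by
  have hfib : typeCard (n + 1) k = ∑ i, prefixCard (n + 1) (fun _ : Fin 1 => i) k := by
    classical
    simp only [typeCard, prefixCard]
    rw [Finset.card_eq_sum_card_fiberwise (f := fun w : Fin (n + 1) → X => w 0)
      (t := Finset.univ) (fun _ _ => Finset.mem_coe.2 (Finset.mem_univ _))]
    refine Finset.sum_congr rfl fun i _ => congrArg _ ?_
    ext w
    simp only [Finset.mem_filter, Finset.mem_univ, true_and]
    constructor
    · rintro ⟨h1, h2⟩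
      refine ⟨⟨by omega, fun l => ?_⟩, h1⟩
      rw [← h2]
      congr 1
      ext
      simp
    · rintro ⟨⟨h, h1⟩, h2⟩
      exact ⟨h2, h1 0⟩
  rw [hfib]
  refine Finset.sum_congr rfl fun i _ => ?_
  have hc : ∀ j, count (fun _ : Fin 1 => i) j = if i = j then 1 else 0 := by
    intro j
    rw [count_eq_sum]
    simp
  split_ifs with h
  · rw [add_comm n 1, ← prefixCard_add n (fun _ : Fin 1 => i)]
    congr 1
    ext j
    rw [Pi.add_apply, hc]
    by_cases hj : i = j
    · subst hj
      simp
      omega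
    · rw [if_neg hj, Function.update_of_ne (Ne.symm hj)]
      simp
  · refine prefixCard_eq_zero _ _ i ?_
    rw [hc]
    simpa using h

/-- The multinomial coefficient, by splitting on the first draw: a first draw `i` contributes `k i *
n !`, and the `k i` add up to `n + 1`. -/
theorem typeCard_mul_prod_factorial (n : ℕ) (k : X → ℕ) (hk : ∑ i, k i = n) :
    typeCard n k * ∏ i, (k i).factorial = n.factorial := by
  classical
  induction n generalizing k with
  | zero =>
    have h0 : k = 0 := by
      ext i
      exact (Finset.sum_eq_zero_iff.1 hk) i (Finset.mem_univ _)
    subst h0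
    have : typeCard 0 (0 : X → ℕ) = 1 := by
      rw [typeCard, Finset.card_eq_one]
      refine ⟨Fin.elim0, ?_⟩
      ext w
      simp only [Finset.mem_filter, Finset.mem_univ, true_and, Finset.mem_singleton]
      constructor
      · intro _
        exact Subsingleton.elim _ _
      · intro _
        ext i
        simp [count]
    simp [this]
  | succ n ih =>
    rw [typeCard_succ, Finset.sum_mul, Nat.factorial_succ, ← hk, Finset.sum_mul]
    refine Finset.sum_congr rfl fun i _ => ?_
    split_ifs with h
    · have hs : ∑ j, Function.update k i (k i - 1) j = n := by
        rw [Finset.sum_update_of_mem (Finset.mem_univ i)]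
        rw [← Finset.add_sum_erase _ _ (Finset.mem_univ i), ← Finset.sdiff_singleton_eq_erase] at hk
        omega
      have h2 := ih _ hs
      have h3 : ∏ j, (k j).factorial = k i * ∏ j, (Function.update k i (k i - 1) j).factorial := by
        rw [← Finset.mul_prod_erase _ _ (Finset.mem_univ i),
          ← Finset.mul_prod_erase (a := i) _ (fun j => (Function.update k i (k i - 1) j).factorial)
            (Finset.mem_univ i), Function.update_self, ← mul_assoc,
          Nat.mul_factorial_pred (by omega)]
        congr 1
        refine Finset.prod_congr rfl fun j hj => ?_
        rw [Function.update_of_ne (Finset.ne_of_mem_erase hj)]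
      rw [h3, ← h2]
      ring
    · have : k i = 0 := by omega
      simp [this]

theorem typeCard_pos (n : ℕ) (k : X → ℕ) (hk : ∑ i, k i = n) : 0 < typeCard n k := by
  rcases Nat.eq_zero_or_pos (typeCard n k) with h | h
  · have := typeCard_mul_prod_factorial n k hk
    rw [h, zero_mul] at this
    exact absurd this.symm (Nat.factorial_ne_zero n)
  · exact h

/-- Given the type, the first draws are draws without replacement. -/
theorem prefixCard_mul_descFactorial {n t : ℕ} (ht : t ≤ n) (x : Fin t → X) (k : X → ℕ)
    (hk : ∑ i, k i = n) :
    prefixCard n x k * n.descFactorial t =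
      typeCard n k * ∏ i, (k i).descFactorial (count x i) := by
  by_cases h : ∀ i, count x i ≤ k i
  · obtain ⟨k', rfl⟩ : ∃ k', k = count x + k' :=
      ⟨fun i => k i - count x i, by ext i; have := h i; simp; omega⟩
    obtain ⟨m, rfl⟩ := Nat.exists_eq_add_of_le ht
    have hk' : ∑ i, k' i = m := by
      simp only [Pi.add_apply, Finset.sum_add_distrib, sum_count] at hk
      omega
    rw [prefixCard_add]
    have e1 := typeCard_mul_prod_factorial m k' hk'
    have e2 := typeCard_mul_prod_factorial (t + m) _ hk
    have e3 : ∏ i, ((count x + k') i).factorial =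
        (∏ i, (k' i).factorial) * ∏ i, ((count x + k') i).descFactorial (count x i) := by
      rw [← Finset.prod_mul_distrib]
      refine Finset.prod_congr rfl fun i _ => ?_
      have := Nat.factorial_mul_descFactorial (h i)
      rw [← this]
      simp
    have e4 : m.factorial * (t + m).descFactorial t = (t + m).factorial := by
      have := Nat.factorial_mul_descFactorial ht
      simpa using this
    have hp : 0 < ∏ i, (k' i).factorial := Finset.prod_pos fun i _ => Nat.factorial_pos _
    refine Nat.eq_of_mul_eq_mul_right hp ?_
    calc typeCard m k' * (t + m).descFactorial t * ∏ i, (k' i).factorial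
        = (typeCard m k' * ∏ i, (k' i).factorial) * (t + m).descFactorial t := by ring
      _ = typeCard (t + m) (count x + k') * ∏ i, ((count x + k') i).factorial := by
          rw [e1, e4, e2]
      _ = _ := by rw [e3]; ring
  · push Not at h
    obtain ⟨i, hi⟩ := h
    rw [prefixCard_eq_zero x k i hi, zero_mul, Finset.prod_eq_zero (Finset.mem_univ i), mul_zero]
    exact Nat.descFactorial_eq_zero_iff_lt.2 hi

/-! ### Event probabilities as sums over count vectors. -/

/-- The probability of a type, up to a factor that depends only on the number of draws. -/
def typeWeight (α : X → ℕ) (c : ℤ) (k : X → ℕ) : ℝ :=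
  ∏ i, risingProd (α i) c (k i) / (k i).factorial

/-- The probability of the first draws `x` given the vector of counts `k` of `n` draws. -/
def prefixRatio (n : ℕ) {t : ℕ} (x : Fin t → X) (k : X → ℕ) : ℝ :=
  (∏ i, ((k i).descFactorial (count x i) : ℝ)) / n.descFactorial t

open Classical in
/-- The vectors of counts of `n` draws whose type lies in `S`. -/
def typeVecs (n : ℕ) (S : Set (X → ℝ)) : Finset (X → ℕ) :=
  (Finset.piAntidiag Finset.univ n).filter fun k => (fun i => (k i : ℝ) / n) ∈ S

theorem mem_typeVecs {n : ℕ} {S : Set (X → ℝ)} {k : X → ℕ} :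
    k ∈ typeVecs n S ↔ ∑ i, k i = n ∧ (fun i => (k i : ℝ) / n) ∈ S := by
  classical
  simp [typeVecs, Finset.mem_piAntidiag]

theorem card_typeVecs_le (n : ℕ) (S : Set (X → ℝ)) :
    (typeVecs n S).card ≤ (n + 1) ^ Fintype.card X := by
  classical
  have h : typeVecs n S ⊆ Fintype.piFinset fun _ : X => Finset.range (n + 1) := by
    intro k hk
    rw [mem_typeVecs] at hk
    rw [Fintype.mem_piFinset]
    intro i
    rw [Finset.mem_range, Nat.lt_succ_iff, ← hk.1]
    exact Finset.single_le_sum (f := k) (fun _ _ => Nat.zero_le _) (Finset.mem_univ i)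
  refine (Finset.card_le_card h).trans_eq ?_
  simp [Fintype.card_piFinset]

/-- Groups the sequences by their counts. The free event `E` lets it serve both the type event (`E =
univ`) and its intersection with a prefix event. -/
theorem prob_eq_sum_typeVecs (α : X → ℕ) (c : ℤ) {n : ℕ} (S : Set (X → ℝ))
    {E E' : Set (Fin n → X)} (hE : ∀ w, w ∈ E' ↔ w ∈ E ∧ w ∈ typeEvent n S) (m : (X → ℕ) → ℕ)
    (hm : ∀ k, m k = Nat.card {w : Fin n → X // w ∈ E ∧ count w = k}) :
    prob α c E' = ∑ k ∈ typeVecs n S,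
      m k * ((∏ i, risingProd (α i) c (k i)) / risingProd (total α) c n) := by
  classical
  have hmaps : ∀ w ∈ Finset.univ.filter (fun w : Fin n → X => w ∈ E'),
      count w ∈ typeVecs n S := by
    intro w hw
    rw [Finset.mem_filter, hE] at hw
    exact mem_typeVecs.2 ⟨sum_count w, hw.2.2⟩
  rw [prob]
  simp_rw [seqProb_eq]
  rw [← Finset.sum_filter]
  trans ∑ w ∈ Finset.univ.filter (fun w : Fin n → X => w ∈ E'),
    (∏ i, risingProd (α i) c (count w i)) / risingProd (total α) c n
  · congr!
  rw [← Finset.sum_fiberwise_of_maps_to hmaps]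
  refine Finset.sum_congr rfl fun k hk => ?_
  rw [Finset.sum_congr rfl
    (g := fun _ => (∏ i, risingProd (α i) c (k i)) / risingProd (total α) c n)
    (fun w hw => by rw [(Finset.mem_filter.1 hw).2]), Finset.sum_const, nsmul_eq_mul, hm,
    Nat.card_eq_fintype_card, Fintype.card_subtype, Finset.filter_filter]
  congr 3
  ext w
  simp only [Finset.mem_filter, Finset.mem_univ, true_and, hE]
  constructor
  · rintro ⟨⟨h1, -⟩, h2⟩
    exact ⟨h1, h2⟩
  · rintro ⟨h1, rfl⟩
    exact ⟨⟨h1, (mem_typeVecs.1 hk).2⟩, rfl⟩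

theorem typeCard_mul_prod_risingProd (α : X → ℕ) (c : ℤ) {n : ℕ} {k : X → ℕ}
    (hk : ∑ i, k i = n) :
    (typeCard n k : ℝ) * ∏ i, risingProd (α i) c (k i) = n.factorial * typeWeight α c k := by
  rw [typeWeight, Finset.prod_div_distrib, ← typeCard_mul_prod_factorial n k hk]
  have : (∏ i, ((k i).factorial : ℝ)) ≠ 0 :=
    Finset.prod_ne_zero_iff.2 fun i _ => by exact_mod_cast Nat.factorial_ne_zero _
  push_cast
  field_simp

theorem prob_typeEvent (α : X → ℕ) (c : ℤ) (n : ℕ) (S : Set (X → ℝ)) :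
    prob α c (typeEvent n S) =
      n.factorial / risingProd (total α) c n * ∑ k ∈ typeVecs n S, typeWeight α c k := by
  classical
  rw [prob_eq_sum_typeVecs α c S (E := Set.univ) (by simp) (typeCard n)
    (fun k => by simp [typeCard, Nat.card_eq_fintype_card, Fintype.card_subtype])]
  rw [Finset.mul_sum]
  refine Finset.sum_congr rfl fun k hk => ?_
  rw [mul_div_assoc', typeCard_mul_prod_risingProd α c (mem_typeVecs.1 hk).1]
  ring

theorem prob_prefixEvent_inter_typeEvent (α : X → ℕ) (c : ℤ) {n t : ℕ} (ht : t ≤ n)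
    (x : Fin t → X) (S : Set (X → ℝ)) :
    prob α c (prefixEvent n x ∩ typeEvent n S) =
      n.factorial / risingProd (total α) c n *
        ∑ k ∈ typeVecs n S, typeWeight α c k * prefixRatio n x k := by
  classical
  rw [prob_eq_sum_typeVecs α c S (E := prefixEvent n x) (fun w => Set.mem_inter_iff w _ _)
    (prefixCard n x)
    (fun k => by rw [prefixCard, Nat.card_eq_fintype_card, Fintype.card_subtype])]
  rw [Finset.mul_sum]
  refine Finset.sum_congr rfl fun k hk => ?_
  have h1 : (prefixCard n x k : ℝ) = typeCard n k * prefixRatio n x k := by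
    have h2 : (n.descFactorial t : ℝ) ≠ 0 := by
      exact_mod_cast Nat.descFactorial_eq_zero_iff_lt.not.2 (not_lt.2 ht)
    rw [prefixRatio, mul_div_assoc', eq_div_iff h2]
    exact_mod_cast prefixCard_mul_descFactorial ht x k (mem_typeVecs.1 hk).1
  rw [h1, mul_div_assoc', mul_right_comm,
    typeCard_mul_prod_risingProd α c (mem_typeVecs.1 hk).1]
  ring

theorem risingProd_pos {a c : ℝ} {k : ℕ} (h : ∀ j < k, 0 < a + c * j) : 0 < risingProd a c k :=
  Finset.prod_pos fun j hj => h j (Finset.mem_range.1 hj)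

theorem typeWeight_pos {α : X → ℕ} {c : ℤ} {n : ℕ} (h : ∀ i, ∀ j < n, 0 < (α i : ℝ) + c * j)
    {k : X → ℕ} (hk : ∑ i, k i = n) : 0 < typeWeight α c k := by
  refine Finset.prod_pos fun i _ => div_pos (risingProd_pos fun j hj => h i j ?_)
    (by exact_mod_cast Nat.factorial_pos _)
  refine hj.trans_le ?_
  rw [← hk]
  exact Finset.single_le_sum (f := k) (fun _ _ => Nat.zero_le _) (Finset.mem_univ i)

theorem apply_le_total (α : X → ℕ) (i : X) : α i ≤ total α :=
  Finset.single_le_sum (f := α) (fun _ _ => Nat.zero_le _) (Finset.mem_univ i)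

theorem risingProd_total_pos [Nonempty X] {α : X → ℕ} {c : ℤ} {n : ℕ}
    (h : ∀ i, ∀ j < n, 0 < (α i : ℝ) + c * j) : 0 < risingProd (total α) c n := by
  obtain ⟨i⟩ := ‹Nonempty X›
  refine risingProd_pos fun j hj => (h i j hj).trans_le ?_
  have : (α i : ℝ) ≤ total α := by exact_mod_cast apply_le_total α i
  linarith

theorem prob_typeEvent_pos_iff [Nonempty X] {α : X → ℕ} {c : ℤ} {n : ℕ} {S : Set (X → ℝ)}
    (h : ∀ i, ∀ j < n, 0 < (α i : ℝ) + c * j) :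
    0 < prob α c (typeEvent n S) ↔ (typeVecs n S).Nonempty := by
  rw [prob_typeEvent]
  have h1 : (0 : ℝ) < n.factorial / risingProd (total α) c n :=
    div_pos (by exact_mod_cast Nat.factorial_pos _) (risingProd_total_pos h)
  rw [mul_pos_iff_of_pos_left h1]
  constructor
  · intro h2
    by_contra h3
    rw [Finset.not_nonempty_iff_eq_empty] at h3
    simp [h3] at h2
  · intro h2
    exact Finset.sum_pos (fun k hk => typeWeight_pos h (mem_typeVecs.1 hk).1) h2

theorem condProb_eq [Nonempty X] {α : X → ℕ} {c : ℤ} {n t : ℕ} (ht : t ≤ n)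
    (h : ∀ i, ∀ j < n, 0 < (α i : ℝ) + c * j) (x : Fin t → X) (S : Set (X → ℝ)) :
    condProb α c (prefixEvent n x) (typeEvent n S) =
      (∑ k ∈ typeVecs n S, typeWeight α c k * prefixRatio n x k) /
        ∑ k ∈ typeVecs n S, typeWeight α c k := by
  have h1 : (0 : ℝ) < n.factorial / risingProd (total α) c n :=
    div_pos (by exact_mod_cast Nat.factorial_pos _) (risingProd_total_pos h)
  rw [condProb, prob_prefixEvent_inter_typeEvent α c ht, prob_typeEvent,
    mul_div_mul_left _ _ h1.ne']

theorem prefixRatio_nonneg (n : ℕ) {t : ℕ} (x : Fin t → X) (k : X → ℕ) :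
    0 ≤ prefixRatio n x k := by
  unfold prefixRatio
  positivity

theorem prefixCard_le_typeCard (n : ℕ) {t : ℕ} (x : Fin t → X) (k : X → ℕ) :
    prefixCard n x k ≤ typeCard n k := by
  classical
  refine Finset.card_le_card fun w hw => ?_
  simp only [Finset.mem_filter, Finset.mem_univ, true_and] at hw ⊢
  exact hw.2

theorem prefixRatio_le_one {n t : ℕ} (ht : t ≤ n) (x : Fin t → X) {k : X → ℕ}
    (hk : ∑ i, k i = n) : prefixRatio n x k ≤ 1 := by
  have h2 : 0 < n.descFactorial t := 
    Nat.pos_of_ne_zero (Nat.descFactorial_eq_zero_iff_lt.not.2 (not_lt.2 ht))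
  rw [prefixRatio, div_le_one (by exact_mod_cast h2)]
  have h3 := prefixCard_mul_descFactorial ht x k hk
  have h4 := Nat.mul_le_mul_right (n.descFactorial t) (prefixCard_le_typeCard n x k)
  rw [h3] at h4
  exact_mod_cast Nat.le_of_mul_le_mul_left h4 (typeCard_pos n k hk)

/-! ### Exponential form of the weights. -/

/-- The logarithm of a product of `k` terms of an arithmetic progression, each divided by `N`. -/
def logRise (a c N : ℝ) (k : ℕ) : ℝ := ∑ j ∈ Finset.range k, Real.log ((a + c * j) / N)

theorem risingProd_eq_exp {a c N : ℝ} (hN : 0 < N) {k : ℕ} (h : ∀ j < k, 0 < a + c * j) :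
    risingProd a c k = N ^ k * Real.exp (logRise a c N k) := by
  rw [logRise, Real.exp_sum, risingProd]
  conv_rhs => rw [← Finset.card_range k, ← Finset.prod_const, Finset.card_range,
    ← Finset.prod_mul_distrib]
  refine Finset.prod_congr rfl fun j hj => ?_
  rw [Real.exp_log (div_pos (h j (Finset.mem_range.1 hj)) hN)]
  field_simp

theorem factorial_eq_exp {N : ℝ} (hN : 0 < N) (k : ℕ) :
    (k.factorial : ℝ) = N ^ k * Real.exp (logRise 1 1 N k) := by
  rw [← risingProd_eq_exp hN fun j _ => by positivity, risingProd]
  rw [← Finset.prod_range_add_one_eq_factorial]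
  push_cast
  exact Finset.prod_congr rfl fun j _ => by ring

/-- The exponential rate of the weight of a type. -/
def rate (α : X → ℕ) (c : ℤ) (n : ℕ) (k : X → ℕ) : ℝ :=
  ∑ i, (logRise (α i) c (total α) (k i) / n - logRise 1 1 n (k i) / n)

/-- The numerators are scaled by `total α` and the factorials by `n`, so that both sums of
logarithms have limits after division by `n`. The scaling factors `(total α / n) ^ k i` multiply to
a constant because `∑ i, k i = n`. -/
theorem typeWeight_eq_exp [Nonempty X] {α : X → ℕ} {c : ℤ} {n : ℕ} (hn : 0 < n)
    (h : ∀ i, ∀ j < n, 0 < (α i : ℝ) + c * j) {k : X → ℕ} (hk : ∑ i, k i = n) :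
    typeWeight α c k = (total α / n : ℝ) ^ n * Real.exp (n * rate α c n k) := by
  have hn' : (0 : ℝ) < n := by exact_mod_cast hn
  have hN : (0 : ℝ) < total α := by
    obtain ⟨i⟩ := ‹Nonempty X›
    have h1 : (α i : ℝ) ≤ total α := by exact_mod_cast apply_le_total α i
    have h2 := h i 0 hn
    simp at h2
    exact lt_of_lt_of_le (by exact_mod_cast h2) h1
  have hki : ∀ i, k i ≤ n := fun i => by
    rw [← hk]
    exact Finset.single_le_sum (f := k) (fun _ _ => Nat.zero_le _) (Finset.mem_univ i)
  have e : ∀ i, risingProd (α i) c (k i) / (k i).factorial =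
      (total α / n : ℝ) ^ k i *
        Real.exp (n * (logRise (α i) c (total α) (k i) / n - logRise 1 1 n (k i) / n)) := by
    intro i
    rw [risingProd_eq_exp hN fun j hj => h i j (hj.trans_le (hki i)), factorial_eq_exp hn',
      mul_sub, mul_div_cancel₀ _ hn'.ne', mul_div_cancel₀ _ hn'.ne', Real.exp_sub, div_pow,
      mul_div_mul_comm]
  rw [typeWeight, Finset.prod_congr rfl fun i _ => e i, Finset.prod_mul_distrib,
    Finset.prod_pow_eq_pow_sum, hk, rate, Finset.mul_sum, Real.exp_sum]

/-! ### Types in a convex set near a limit of such types. -/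

/-- The cone spanned by `S`. -/
def coneOver (S : Set (X → ℝ)) : Set (X → ℝ) := {v | ∃ s : ℝ, 0 ≤ s ∧ ∃ p ∈ S, v = s • p}

theorem subset_coneOver {S : Set (X → ℝ)} {p : X → ℝ} (hp : p ∈ S) : p ∈ coneOver S :=
  ⟨1, zero_le_one, p, hp, (one_smul _ _).symm⟩

theorem smul_mem_coneOver {S : Set (X → ℝ)} {v : X → ℝ} (hv : v ∈ coneOver S) {a : ℝ}
    (ha : 0 ≤ a) : a • v ∈ coneOver S := by
  obtain ⟨s, hs, p, hp, rfl⟩ := hv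
  exact ⟨a * s, mul_nonneg ha hs, p, hp, by rw [mul_smul]⟩

theorem add_mem_coneOver {S : Set (X → ℝ)} (hconv : Convex ℝ S) {u v : X → ℝ}
    (hu : u ∈ coneOver S) (hv : v ∈ coneOver S) : u + v ∈ coneOver S := by
  obtain ⟨s, hs, p, hp, rfl⟩ := hu
  obtain ⟨s', hs', p', hp', rfl⟩ := hv
  rcases (add_nonneg hs hs').eq_or_lt with h | h
  · have h1 : s = 0 := by linarith
    have h2 : s' = 0 := by linarith
    exact ⟨0, le_rfl, p, hp, by simp [h1, h2]⟩
  · refine ⟨s + s', h.le, (s / (s + s')) • p + (s' / (s + s')) • p',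
      hconv hp hp' (by positivity) (by positivity) (by field_simp), ?_⟩
    rw [smul_add, smul_smul, smul_smul, mul_div_cancel₀ _ h.ne', mul_div_cancel₀ _ h.ne']

theorem sum_mem_coneOver {S : Set (X → ℝ)} (hconv : Convex ℝ S) (hne : S.Nonempty) {ι : Type*}
    (F : Finset ι) (f : ι → X → ℝ) (hf : ∀ j ∈ F, f j ∈ coneOver S) :
    ∑ j ∈ F, f j ∈ coneOver S := by
  classical
  induction F using Finset.induction_on with
  | empty =>
    obtain ⟨p, hp⟩ := hne
    exact ⟨0, le_rfl, p, hp, by simp⟩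
  | insert j F hj ih =>
    rw [Finset.sum_insert hj]
    exact add_mem_coneOver hconv (hf _ (Finset.mem_insert_self _ _))
      (ih fun i hi => hf _ (Finset.mem_insert_of_mem hi))

/-- In the cone the condition on a type no longer involves `n`, so count vectors of different
lengths can be added. The scale `s` is recovered as the coordinate sum, since `S` lies in the
simplex. -/
theorem mem_typeVecs_iff_coneOver {S : Set (X → ℝ)} (hS : S ⊆ stdSimplex ℝ X) {n : ℕ}
    (hn : 0 < n) {k : X → ℕ} :
    k ∈ typeVecs n S ↔ ∑ i, k i = n ∧ (fun i => (k i : ℝ)) ∈ coneOver S := by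
  rw [mem_typeVecs]
  have hn' : (n : ℝ) ≠ 0 := by exact_mod_cast hn.ne'
  refine and_congr_right fun hk => ⟨fun h => ⟨n, n.cast_nonneg, _, h, ?_⟩, ?_⟩
  · ext i
    simp [mul_div_cancel₀ _ hn']
  · rintro ⟨s, -, p, hp, hsp⟩
    have hs : s = n := by
      have h1 : ∑ i, (k i : ℝ) = ∑ i, s * p i :=
        Finset.sum_congr rfl fun i _ => congrFun hsp i
      rw [← Finset.mul_sum, (hS hp).2, mul_one, ← Nat.cast_sum, hk] at h1
      exact h1.symm
    convert hp using 1
    ext i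
    have := congrFun hsp i
    simp only [Pi.smul_apply, smul_eq_mul] at this
    rw [this, hs, mul_div_cancel_left₀ _ hn']

/-- If a point of a convex set `S` is a limit of types in `S` and there is a type in `S` with
denominator `n`, there is one at a distance `O(1 / n)` from that point. -/
theorem exists_typeVecs_near {S : Set (X → ℝ)} (hS : S ⊆ stdSimplex ℝ X) (hconv : Convex ℝ S)
    {p : X → ℝ} (hp : p ∈ S) (hcl : p ∈ closure (⋃ n : ℕ, typesIn n S)) :
    ∃ T : ℕ, ∀ n, T ≤ n → (typeVecs n S).Nonempty →
      ∃ k ∈ typeVecs n S, ∀ i, |(k i : ℝ) - n * p i| ≤ T := by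
  classical
  have hnpos : ∀ {n : ℕ} {k : X → ℕ}, k ∈ typeVecs n S → 0 < n := by
    intro n k hk
    rcases Nat.eq_zero_or_pos n with rfl | h
    · have h1 := (hS (mem_typeVecs.1 hk).2).2
      simp at h1
    · exact h
  have htype : ∀ v ∈ ⋃ n : ℕ, typesIn n S, ∃ n, ∃ k ∈ typeVecs n S, ∀ i, v i = (k i : ℝ) / n := by
    intro v hv
    obtain ⟨n, hv, w, rfl⟩ := Set.mem_iUnion.1 hv
    exact ⟨n, count w, mem_typeVecs.2 ⟨sum_count w, hv⟩, fun i => rfl⟩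
  set G : Set (X → ℝ) := {v | v ∈ coneOver S ∧ ∃ k : X → ℕ, v = fun i => (k i : ℝ)} with hG
  -- A finite-dimensional span is closed, so it contains limits of types. The coefficients of `p`
  -- may be negative; the rounding below allows for this.
  have hspan : p ∈ Submodule.span ℝ G := by
    have hclosed : IsClosed (Submodule.span ℝ G : Set (X → ℝ)) :=
      Submodule.closed_of_finiteDimensional _
    refine hclosed.closure_subset_iff.2 ?_ hcl
    intro v hv
    obtain ⟨n, k, hk, hvk⟩ := htype v hv
    have hk' := (mem_typeVecs_iff_coneOver hS (hnpos hk)).1 hk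
    have : v = (1 / n : ℝ) • fun i => (k i : ℝ) := by
      ext i
      rw [hvk]
      simp
      ring
    rw [this]
    exact Submodule.smul_mem _ _ (Submodule.subset_span ⟨hk'.2, k, rfl⟩)
  obtain ⟨a, F, hFG, -, hsum⟩ := Submodule.mem_span_iff_exists_finset_subset.1 hspan
  have hkk : ∀ v : X → ℝ, ∃ k : X → ℕ, v ∈ F → v = fun i => (k i : ℝ) := by
    intro v
    by_cases hv : v ∈ F
    · obtain ⟨k, hk⟩ := (hFG hv).2
      exact ⟨k, fun _ => hk⟩
    · exact ⟨0, fun h => absurd h hv⟩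
  choose g hg using hkk
  obtain ⟨v0, hv0⟩ : (⋃ n : ℕ, typesIn n S).Nonempty := closure_nonempty_iff.1 ⟨p, hcl⟩
  obtain ⟨d, m, hm, -⟩ := htype v0 hv0
  have hd := hnpos hm
  have hd' : (0 : ℝ) < d := by exact_mod_cast hd
  obtain ⟨hmd, hmC⟩ := (mem_typeVecs_iff_coneOver hS hd).1 hm
  have hres : ∀ r : ℕ, ∃ k : X → ℕ, ∀ n, (typeVecs n S).Nonempty → n % d = r →
      (fun i => (k i : ℝ)) ∈ coneOver S ∧ (∑ i, k i) % d = r := by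
    intro r
    by_cases h : ∃ n, (typeVecs n S).Nonempty ∧ n % d = r
    · obtain ⟨n, ⟨k, hk⟩, hr⟩ := h
      obtain ⟨h1, h2⟩ := (mem_typeVecs_iff_coneOver hS (hnpos hk)).1 hk
      exact ⟨k, fun _ _ _ => ⟨h2, by rw [h1, hr]⟩⟩
    · exact ⟨0, fun n h1 h2 => absurd ⟨n, h1, h2⟩ h⟩
  choose e he using hres
  set B : ℕ := ∑ v ∈ F, ∑ i, g v i
  set E : ℕ := ∑ r ∈ Finset.range d, ∑ i, e r i
  refine ⟨d * B + E, fun n hn hne => ?_⟩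
  set T : ℕ := d * B + E
  have hn0 : 0 < n := by
    obtain ⟨k, hk⟩ := hne
    exact hnpos hk
  obtain ⟨heC, hed⟩ := he _ n hne rfl
  set r := n % d
  have heE : ∑ i, e r i ≤ E :=
    Finset.single_le_sum (f := fun r => ∑ i, e r i) (fun _ _ => Nat.zero_le _)
      (Finset.mem_range.2 (Nat.mod_lt _ hd))
  set s : ℝ := (n : ℝ) - T with hs
  have hs0 : 0 ≤ s := by
    have : (T : ℝ) ≤ n := by exact_mod_cast hn
    linarith
  -- Each coefficient `s * a v` is rounded up to a multiple `d * b v` of `d`. The excess `θ v ∈ [0,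
  -- d]` is nonnegative, so the rounded vector `z = s • p + ∑ θ v • v` stays in the cone whatever
  -- the signs of `a v`, and its coordinate sum is divisible by `d`.
  set b : (X → ℝ) → ℤ := fun v => ⌊s * a v / d⌋ + 1
  set θ : (X → ℝ) → ℝ := fun v => d * b v - s * a v with hθ
  have hθ0 : ∀ v, 0 ≤ θ v := by
    intro v
    have h1 := (Int.lt_floor_add_one (s * a v / d)).le
    rw [div_le_iff₀ hd'] at h1
    simp only [hθ, b]
    push_cast
    linarith
  have hθd : ∀ v, θ v ≤ d := by
    intro v
    have h1 := Int.floor_le (s * a v / d)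
    rw [le_div_iff₀ hd'] at h1
    simp only [hθ, b]
    push_cast
    linarith
  set z : X → ℤ := fun i => d * ∑ v ∈ F, b v * g v i with hz
  have hzv : ∀ i, (z i : ℝ) = s * p i + ∑ v ∈ F, θ v * g v i := by
    intro i
    have h1 : p i = ∑ v ∈ F, a v * g v i := by
      rw [← hsum, Finset.sum_apply]
      refine Finset.sum_congr rfl fun v hv => ?_
      rw [Pi.smul_apply, smul_eq_mul]
      congr 1
      exact congrFun (hg v hv) i
    rw [h1, Finset.mul_sum, ← Finset.sum_add_distrib]
    simp only [hz, hθ]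
    push_cast
    rw [Finset.mul_sum]
    exact Finset.sum_congr rfl fun v _ => by ring
  have hzθ : ∀ i, 0 ≤ ∑ v ∈ F, θ v * g v i := fun i =>
    Finset.sum_nonneg fun v _ => mul_nonneg (hθ0 v) (Nat.cast_nonneg _)
  have hzC : (fun i => (z i : ℝ)) ∈ coneOver S := by
    have h1 : (fun i => (z i : ℝ)) = s • p + ∑ v ∈ F, θ v • v := by
      ext i
      rw [hzv, Pi.add_apply, Finset.sum_apply]
      congr 1
      refine Finset.sum_congr rfl fun v hv => ?_
      rw [Pi.smul_apply, smul_eq_mul]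
      congr 1
      exact (congrFun (hg v hv) i).symm
    rw [h1]
    exact add_mem_coneOver hconv (smul_mem_coneOver (subset_coneOver hp) hs0)
      (sum_mem_coneOver hconv ⟨p, hp⟩ _ _ fun v hv => smul_mem_coneOver (hFG hv).1 (hθ0 v))
  have hz0 : ∀ i, 0 ≤ z i := by
    intro i
    have h1 : (0 : ℝ) ≤ z i := by
      rw [hzv]
      exact add_nonneg (mul_nonneg hs0 ((hS hp).1 i)) (hzθ i)
    exact_mod_cast h1
  have hzsum : ((∑ i, z i : ℤ) : ℝ) ≤ s + d * B := by
    push_cast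
    rw [Finset.sum_congr rfl fun i _ => hzv i, Finset.sum_add_distrib, ← Finset.mul_sum, (hS hp).2,
      mul_one, Finset.sum_comm]
    gcongr
    simp only [B]
    push_cast
    rw [Finset.mul_sum]
    refine Finset.sum_le_sum fun v _ => ?_
    rw [← Finset.mul_sum]
    exact mul_le_mul_of_nonneg_right (hθd v) (Finset.sum_nonneg fun i _ => Nat.cast_nonneg _)
  have hzd : (d : ℤ) ∣ ∑ i, z i := by
    simp only [hz]
    rw [← Finset.mul_sum]
    exact dvd_mul_right _ _
  -- Adding `e r` corrects the residue of the length modulo `d`; the rest of the length is filled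
  -- with `j` copies of `m`, whose coordinate sum is `d`. Reserving `T = d * B + E` in `s = n - T`
  -- makes `j ≥ 0`.
  obtain ⟨j, hj⟩ : (d : ℤ) ∣ (n : ℤ) - ∑ i, z i - ((∑ i, e r i : ℕ) : ℤ) := by
    have h1 : (d : ℤ) ∣ (n : ℤ) - ((∑ i, e r i : ℕ) : ℤ) := by
      have h2 : (∑ i, e r i) ≡ n [MOD d] := hed
      exact h2.dvd
    rw [sub_right_comm]
    exact dvd_sub h1 hzd
  have hj0 : 0 ≤ j := by
    have h1 : ∑ i, z i + ((∑ i, e r i : ℕ) : ℤ) ≤ n := by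
      have h2 : ((∑ i, z i : ℤ) : ℝ) + ((∑ i, e r i : ℕ) : ℝ) ≤ n := by
        have h3 : ((∑ i, e r i : ℕ) : ℝ) ≤ E := by exact_mod_cast heE
        have h4 : (T : ℝ) = d * B + E := by simp [T]
        linarith
      exact_mod_cast h2
    have h5 : 0 ≤ (d : ℤ) * j := by rw [← hj]; linarith
    exact nonneg_of_mul_nonneg_right h5 (by exact_mod_cast hd)
  set k : X → ℕ := fun i => (z i).toNat + e r i + j.toNat * m i with hk
  have hkz : ∀ i, (k i : ℝ) = z i + e r i + j * m i := by
    intro i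
    have h1 : (((z i).toNat : ℤ) : ℝ) = z i := by rw [Int.toNat_of_nonneg (hz0 i)]
    have h2 : ((j.toNat : ℤ) : ℝ) = j := by rw [Int.toNat_of_nonneg hj0]
    simp only [Int.cast_natCast] at h1 h2
    simp only [hk]
    push_cast
    rw [h1, h2]
  have hksum : ∑ i, (k i : ℝ) = n := by
    rw [Finset.sum_congr rfl fun i _ => hkz i, Finset.sum_add_distrib, Finset.sum_add_distrib,
      ← Finset.mul_sum]
    have h1 : ((n : ℤ) : ℝ) - ∑ i, (z i : ℝ) - ∑ i, (e r i : ℝ) = d * j := by exact_mod_cast hj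
    have h2 : ∑ i, (m i : ℝ) = d := by exact_mod_cast hmd
    rw [h2]
    rw [Int.cast_natCast] at h1
    linarith
  refine ⟨k, (mem_typeVecs_iff_coneOver hS hn0).2 ⟨by exact_mod_cast hksum, ?_⟩, ?_⟩
  · have h1 : (fun i => (k i : ℝ)) =
        (fun i => (z i : ℝ)) + (fun i => (e r i : ℝ)) + (j : ℝ) • fun i => (m i : ℝ) := by
      ext i
      rw [hkz]
      rfl
    rw [h1]
    exact add_mem_coneOver hconv (add_mem_coneOver hconv hzC heC)
      (smul_mem_coneOver hmC (by exact_mod_cast hj0))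
  -- All that was added to `s • p` is nonnegative with coordinate sum `n - s = T`, so each
  -- coordinate changes by at most `T`.
  · have hu0 : ∀ i, 0 ≤ (k i : ℝ) - s * p i := by
      intro i
      rw [hkz, hzv]
      have h1 : (0 : ℝ) ≤ e r i := Nat.cast_nonneg _
      have h2 : (0 : ℝ) ≤ j * m i := mul_nonneg (by exact_mod_cast hj0) (Nat.cast_nonneg _)
      linarith [hzθ i]
    intro i
    have hu : (k i : ℝ) - s * p i ≤ T := by
      have h1 := Finset.single_le_sum (f := fun i => (k i : ℝ) - s * p i) (fun i _ => hu0 i)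
        (Finset.mem_univ i)
      simp only [Finset.sum_sub_distrib, ← Finset.mul_sum] at h1
      rw [hksum, (hS hp).2] at h1
      linarith
    have hp0 := (hS hp).1 i
    have hp1 : p i ≤ 1 := by
      rw [← (hS hp).2]
      exact Finset.single_le_sum (f := p) (fun i _ => (hS hp).1 i) (Finset.mem_univ i)
    have hT : (0 : ℝ) ≤ T := Nat.cast_nonneg _
    rw [abs_le]
    have h0 := hu0 i
    rw [hs] at hu h0
    constructor <;> nlinarith

/-- If some type lies in a convex set, types of infinitely many denominators do. -/
theorem frequently_typeVecs_nonempty {S : Set (X → ℝ)} (hS : S ⊆ stdSimplex ℝ X)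
    (hne : (⋃ n : ℕ, typesIn n S).Nonempty) : ∃ᶠ n in atTop, (typeVecs n S).Nonempty := by
  obtain ⟨v, hv⟩ := hne
  obtain ⟨n, hv, w, rfl⟩ := Set.mem_iUnion.1 hv
  have hn : n ≠ 0 := by
    rintro rfl
    have h1 := (hS hv).2
    simp [empType] at h1
  rw [frequently_atTop]
  intro N
  -- Multiplying all counts by `N + 1` leaves the type unchanged.
  refine ⟨n * (N + 1), by nlinarith [Nat.pos_of_ne_zero hn], fun i => count w i * (N + 1),
    mem_typeVecs.2 ⟨by rw [← Finset.sum_mul, sum_count], ?_⟩⟩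
  convert hv using 1
  ext i
  rw [empType]
  push_cast
  rw [mul_div_mul_right]
  positivity

/-! ### Sums of logarithms along arithmetic progressions. -/

/-- The antiderivative `x log x - x` of the logarithm. -/
def logPrim (x : ℝ) : ℝ := x * Real.log x - x

theorem continuous_logPrim : Continuous logPrim :=
  Real.continuous_mul_log.sub continuous_id

/-- The convex function `logPrim` lies above its tangent at `x`, including at the boundary point `y
= 0`. -/
theorem log_mul_sub_le_logPrim_sub {x y : ℝ} (hx : 0 < x) (hy : 0 ≤ y) :
    Real.log x * (y - x) ≤ logPrim y - logPrim x := by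
  unfold logPrim
  rcases hy.eq_or_lt with rfl | hy
  · simp
    nlinarith
  · have h1 := Real.log_le_sub_one_of_pos (div_pos hx hy)
    rw [Real.log_div hx.ne' hy.ne'] at h1
    have h2 := mul_le_mul_of_nonneg_left h1 hy.le
    rw [mul_sub, mul_sub, mul_div_cancel₀ _ hy.ne'] at h2
    linarith

/-- Sums the tangent inequalities at the left end of each step. The factor `c / N` is kept on the
left so that no case distinction on the sign of `c` arises. The progression may reach `0` just after
its last term, as when a colour is exhausted. -/
theorem mul_logRise_le {a c N : ℝ} (hN : 0 < N) (k : ℕ) (hpos : ∀ j < k, 0 < a + c * j)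
    (hend : 0 ≤ a + c * k) :
    c / N * logRise a c N k ≤ logPrim ((a + c * k) / N) - logPrim (a / N) := by
  induction k with
  | zero => simp [logRise]
  | succ k ih =>
    have h0 := hpos k (Nat.lt_succ_self k)
    have h1 := ih (fun j hj => hpos j (hj.trans (Nat.lt_succ_self k))) h0.le
    have h2 := log_mul_sub_le_logPrim_sub (div_pos h0 hN) (div_nonneg hend hN.le)
    rw [logRise, Finset.sum_range_succ, ← logRise, mul_add]
    have h3 : (a + c * (k + 1 : ℕ)) / N - (a + c * k) / N = c / N := by
      push_cast
      ring
    rw [h3] at h2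
    linarith

/-- The tangents are now taken at the right end of each step, so the first term of the sum is left
over and appears as an error. With `k + 1` terms only `a, …, a + c k` need be positive. -/
theorem le_mul_logRise {a c N : ℝ} (hN : 0 < N) (k : ℕ) (hpos : ∀ j ≤ k, 0 < a + c * j) :
    logPrim ((a + c * k) / N) - logPrim (a / N) + c / N * Real.log (a / N) ≤
      c / N * logRise a c N (k + 1) := by
  induction k with
  | zero => simp [logRise]
  | succ k ih =>
    have h0 := hpos k (Nat.le_succ k)
    have h1 := ih (fun j hj => hpos j (hj.trans (Nat.le_succ k)))
    have h2 := log_mul_sub_le_logPrim_sub (div_pos (hpos (k + 1) le_rfl) hN)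
      (div_nonneg h0.le hN.le)
    rw [logRise, Finset.sum_range_succ, ← logRise, mul_add]
    have h3 : (a + c * k) / N - (a + c * (k + 1 : ℕ)) / N = -(c / N) := by
      push_cast
      ring
    rw [h3] at h2
    linarith

theorem tendsto_log_div_atTop {ι : Type*} {l : Filter ι} {N : ι → ℝ} (hN : Tendsto N l atTop) :
    Tendsto (fun m => Real.log (N m) / N m) l (𝓝 0) :=
  (Real.isLittleO_log_id_atTop.tendsto_div_nhds_zero).comp hN

theorem abs_log_div_le {a N : ℝ} (ha : 1 ≤ a) (haN : a ≤ N) : |Real.log (a / N)| ≤ Real.log N := by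
  have hN : 0 < N := by linarith
  rw [Real.log_div (by linarith) hN.ne', abs_le]
  have h1 := Real.log_nonneg ha
  have h2 := Real.log_le_log (by linarith) haN
  constructor <;> linarith

/-- Squeeze between the two bounds, the lower one used with `k - 1`. The left-over term is at most
`|c| log N / N` because `1 ≤ a ≤ N`; this is where at least one ball of each colour is needed even
if `a / N → 0`. -/
theorem tendsto_logRise {ι : Type*} {l : Filter ι} {a k : ι → ℕ} {N : ι → ℝ} {c y z : ℝ}
    (hc : c ≠ 0) (hN : Tendsto N l atTop) (ha : ∀ᶠ m in l, 1 ≤ a m)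
    (haN : ∀ᶠ m in l, (a m : ℝ) ≤ N m) (hpos : ∀ᶠ m in l, ∀ j < k m, 0 < (a m : ℝ) + c * j)
    (hend : ∀ᶠ m in l, 0 ≤ (a m : ℝ) + c * k m)
    (hy : Tendsto (fun m => (a m : ℝ) / N m) l (𝓝 y))
    (hz : Tendsto (fun m => (k m : ℝ) / N m) l (𝓝 z)) :
    Tendsto (fun m => logRise (a m) c (N m) (k m) / N m) l
      (𝓝 ((logPrim (y + c * z) - logPrim y) / c)) := by
  have hN0 : ∀ᶠ m in l, 0 < N m := hN.eventually_gt_atTop 0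
  have hinv : Tendsto (fun m => 1 / N m) l (𝓝 0) := by
    exact hN.const_div_atTop 1
  have hz' : Tendsto (fun m => ((k m - 1 : ℕ) : ℝ) / N m) l (𝓝 z) := by
    have h1 : Tendsto (fun m => (k m : ℝ) / N m - 1 / N m) l (𝓝 z) := by
      simpa using hz.sub hinv
    refine tendsto_of_tendsto_of_tendsto_of_le_of_le' h1 hz ?_ ?_
    · filter_upwards [hN0] with m hm
      rw [← sub_div]
      gcongr
      rw [sub_le_iff_le_add]
      exact_mod_cast (by omega : k m ≤ k m - 1 + 1)
    · filter_upwards [hN0] with m hm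
      gcongr
      exact Nat.sub_le _ _
  have hG : ∀ {κ : ι → ℝ}, Tendsto (fun m => κ m / N m) l (𝓝 z) →
      Tendsto (fun m => logPrim ((a m + c * κ m) / N m) - logPrim (a m / N m)) l
        (𝓝 (logPrim (y + c * z) - logPrim y)) := by
    intro κ hκ
    refine Tendsto.sub ((continuous_logPrim.tendsto _).comp ?_)
      ((continuous_logPrim.tendsto _).comp hy)
    refine (hy.add (hκ.const_mul c)).congr fun m => ?_
    ring
  have herr : Tendsto (fun m => |c| * (Real.log (N m) / N m)) l (𝓝 0) := by
    simpa using (tendsto_log_div_atTop hN).const_mul |c|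
  have hmain : Tendsto (fun m => c / N m * logRise (a m) c (N m) (k m)) l
      (𝓝 (logPrim (y + c * z) - logPrim y)) := by
    have hlow := (hG hz').sub herr
    rw [sub_zero] at hlow
    refine tendsto_of_tendsto_of_tendsto_of_le_of_le' hlow (hG hz) ?_ ?_
    · filter_upwards [hN0, ha, haN, hpos] with m hm ha haN hpos
      have h1 : |c / N m * Real.log (a m / N m)| ≤ |c| * (Real.log (N m) / N m) := by
        rw [abs_mul, abs_div, abs_of_pos hm]
        have := abs_log_div_le (by exact_mod_cast ha) haN
        calc |c| / N m * |Real.log (a m / N m)| ≤ |c| / N m * Real.log (N m) := by gcongr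
          _ = _ := by ring
      have h2 := (abs_le.1 h1).1
      rcases Nat.eq_zero_or_pos (k m) with h0 | h0
      · simp only [h0, logRise]
        simp
        have := (abs_nonneg _).trans h1
        linarith
      · have h3 := le_mul_logRise hm (k m - 1) (a := a m) (c := c)
          fun j hj => hpos j (by omega)
        rw [Nat.sub_add_cancel h0] at h3
        linarith
    · filter_upwards [hN0, hpos, hend] with m hm hpos hend
      exact mul_logRise_le hm _ hpos hend
  refine (hmain.div_const c).congr fun m => ?_
  field_simp

/-- The limit of `log (k ! / n ^ k) / n` when `k / n` tends to `x`. -/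
theorem tendsto_logRise_one {ι : Type*} {l : Filter ι} {n k : ι → ℕ} {x : ℝ}
    (hn : Tendsto n l atTop) (hx : Tendsto (fun m => (k m : ℝ) / n m) l (𝓝 x)) :
    Tendsto (fun m => logRise 1 1 (n m) (k m) / n m) l (𝓝 (logPrim x)) := by
  have hn' : Tendsto (fun m => (n m : ℝ)) l atTop := tendsto_natCast_atTop_atTop.comp hn
  have h := tendsto_logRise (a := fun _ => 1) (c := 1) (y := 0) one_ne_zero hn'
    (Eventually.of_forall fun _ => le_rfl)
    ((hn'.eventually_ge_atTop 1).mono fun m hm => by simpa using hm)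
    (Eventually.of_forall fun m j _ => by positivity)
    (Eventually.of_forall fun m => by positivity)
    (by simpa only [Nat.cast_one] using hn'.const_div_atTop 1) hx
  simpa [logPrim] using h

/-! ### The divergence as a sum of limiting rates, and its strict convexity. -/

/-- The limit of `n⁻¹ ∑_{j < k} log ((a + c j) / N)` when `k / n`, `a / N` and `n / N` tend to
`x`, `y` and `β`. -/
def riseLimit (β : ℝ) (c : ℤ) (x y : ℝ) : ℝ :=
  if c = 0 then x * Real.log y else (logPrim (y + β * c * x) - logPrim y) / (β * c)

/-- The contribution of one colour to the finite Polya divergence, up to an additive constant. -/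
def rateTerm (β : ℝ) (c : ℤ) (x y : ℝ) : ℝ := logPrim x - riseLimit β c x y

/-- The finiteness condition for the Polya divergence. -/
def FiniteDiv (c : ℤ) (p q : X → ℝ) : Prop := c = 0 → ∀ i, q i = 0 → p i = 0

/-- With `b = β c`, the logarithms of `y + b x` combine to `(y + b x) log (y + b x) / b`, and the
linear parts of `logPrim` cancel. This form is continuous at `y + b x = 0`, where it gives the
prescribed limit. -/
theorem polyaTerm_eq_rateTerm {β : ℝ} {c : ℤ} (hc : c ≠ 0) (hβ : 0 < β) {x y : ℝ} (hx : 0 ≤ x)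
    (hy : 0 ≤ y) (hxy : 0 ≤ y + β * c * x) : polyaTerm (β * c) x y = rateTerm β c x y := by
  have hb : β * (c : ℝ) ≠ 0 := mul_ne_zero hβ.ne' (by exact_mod_cast hc)
  unfold polyaTerm rateTerm riseLimit logPrim
  rw [if_neg hc]
  generalize β * (c : ℝ) = b at *
  split_ifs with h
  · have hyb : y = -b * x := by linarith
    rw [h]
    rcases hx.eq_or_lt with rfl | hx
    · simp [hyb]
    · have hb' : 0 < -b := by
        rcases lt_or_ge 0 (-b) with h1 | h1
        · exact h1
        · have : b ≠ 0 := hb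
          have h2 : 0 < b := lt_of_le_of_ne (by linarith) this.symm
          nlinarith [mul_pos h2 hx]
      rw [hyb, Real.log_mul hb'.ne' hx.ne']
      field_simp
      ring
  · have hpos : 0 < y + b * x := lt_of_le_of_ne hxy (Ne.symm h)
    have e1 : x * Real.log (x / (y + b * x)) = x * Real.log x - x * Real.log (y + b * x) := by
      rcases hx.eq_or_lt with rfl | hx
      · simp
      · rw [Real.log_div hx.ne' h]; ring
    have e2 : y * Real.log (y / (y + b * x)) = y * Real.log y - y * Real.log (y + b * x) := by
      rcases hy.eq_or_lt with rfl | hy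
      · simp
      · rw [Real.log_div hy.ne' h]; ring
    rw [e1, e2]
    field_simp
    ring

/-- The difference between the finite Polya divergence and the sum of the contributions. -/
def divConst (β : ℝ) (c : ℤ) : ℝ :=
  if c = 0 then 1 else (1 + β * c) / (β * c) * Real.log (1 + β * c)

/-- For `c = 0` the constant is `1` because `rateTerm` equals `x log (x / y) - x` and the entries of
`p` add up to `1`. -/
theorem divergence_eq_coe {β : ℝ} {c : ℤ} (hβ : 0 < β) {p q : X → ℝ} (hp : p ∈ stdSimplex ℝ X)
    (hq : ∀ i, 0 ≤ q i) (hpq : ∀ i, 0 ≤ q i + β * c * p i) (hfin : FiniteDiv c p q) :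
    divergence β c p q = ((∑ i, rateTerm β c (p i) (q i) + divConst β c : ℝ) : EReal) := by
  unfold divergence divConst
  by_cases hc : c = 0
  · rw [if_pos hc, if_pos hc, kl]
    have h1 : ∀ i, klTerm (p i) (q i) = ((rateTerm β c (p i) (q i) + p i : ℝ) : EReal) := by
      intro i
      unfold klTerm rateTerm riseLimit logPrim
      rw [if_pos hc]
      split_ifs with h2 h3
      · simp [h2]
      · exact absurd (hfin hc i h3) h2
      · rw [Real.log_div h2 h3]
        congr 1
        ring
    rw [Finset.sum_congr rfl fun i _ => h1 i, ← hp.2, ← Finset.sum_add_distrib]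
    exact (map_sum (⟨⟨Real.toEReal, EReal.coe_zero⟩, EReal.coe_add⟩ : ℝ →+ EReal) _ _).symm
  · rw [if_neg hc, if_neg hc,
      Finset.sum_congr rfl fun i _ => polyaTerm_eq_rateTerm hc hβ (hp.1 i) (hq i) (hpq i)]

theorem sum_ne_bot {ι : Type*} (s : Finset ι) (f : ι → EReal) (h : ∀ i ∈ s, f i ≠ ⊥) :
    ∑ i ∈ s, f i ≠ ⊥ := by
  classical
  induction s using Finset.induction_on with
  | empty => simp
  | insert i s hi ih =>
    rw [Finset.sum_insert hi]
    exact EReal.add_ne_bot_iff.2 ⟨h i (Finset.mem_insert_self _ _),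
      ih fun j hj => h j (Finset.mem_insert_of_mem hj)⟩

theorem divergence_eq_top {β : ℝ} {c : ℤ} {p q : X → ℝ} (hfin : ¬ FiniteDiv c p q) :
    divergence β c p q = ⊤ := by
  classical
  unfold FiniteDiv at hfin
  push Not at hfin
  obtain ⟨hc, i, hq, hp⟩ := hfin
  rw [divergence, if_pos hc, kl, ← Finset.add_sum_erase _ _ (Finset.mem_univ i), klTerm,
    if_neg hp, if_pos hq]
  refine EReal.top_add_of_ne_bot (sum_ne_bot _ _ fun j _ => ?_)
  unfold klTerm
  split_ifs
  · exact EReal.zero_ne_bot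
  · exact top_ne_bot
  · exact EReal.coe_ne_bot _

theorem hasDerivAt_logPrim {x : ℝ} (hx : x ≠ 0) : HasDerivAt logPrim (Real.log x) x := by
  have h := ((Real.hasDerivAt_mul_log hx).sub (hasDerivAt_id x))
  simp only [add_sub_cancel_right] at h
  exact h

/-- The derivative is `log (x / (y + β c x))`, and this quotient is strictly increasing precisely
because `y > 0`. For `y = 0` and `c ≠ 0` it is constant, so strict convexity can fail. -/
theorem strictConvexOn_rateTerm {β : ℝ} {c : ℤ} (hβ : 0 < β) {y : ℝ} (hy : 0 < y)
    (hyb : 0 ≤ y + β * c) : StrictConvexOn ℝ (Set.Icc 0 1) fun x => rateTerm β c x y := by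
  have hpos : ∀ x ∈ Set.Ioo (0 : ℝ) 1, 0 < y + β * c * x := by
    intro x hx
    have h1 : y + β * c * x = (1 - x) * y + x * (y + β * c) := by ring
    rw [h1]
    exact add_pos_of_pos_of_nonneg (mul_pos (by linarith [hx.2]) hy) (mul_nonneg hx.1.le hyb)
  have hderiv : ∀ x ∈ Set.Ioo (0 : ℝ) 1,
      HasDerivAt (fun x => rateTerm β c x y) (Real.log x - Real.log (y + β * c * x)) x := by
    intro x hx
    refine (hasDerivAt_logPrim hx.1.ne').sub ?_
    unfold riseLimit
    split_ifs with hc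
    · simpa [hc] using (hasDerivAt_id x).mul_const (Real.log y)
    · have hb : β * (c : ℝ) ≠ 0 := mul_ne_zero hβ.ne' (by exact_mod_cast hc)
      have h1 : HasDerivAt (fun x => y + β * c * x) (β * c) x := by
        simpa using ((hasDerivAt_id x).const_mul (β * (c : ℝ))).const_add y
      have h2 := (((hasDerivAt_logPrim (hpos x hx).ne').comp x h1).sub_const
        (logPrim y)).div_const (β * c)
      rw [mul_div_cancel_right₀ _ hb] at h2
      exact h2
  refine StrictMonoOn.strictConvexOn_of_deriv (convex_Icc 0 1) ?_ ?_
  · refine (continuous_logPrim.sub ?_).continuousOn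
    unfold riseLimit
    split_ifs
    · fun_prop
    · exact ((continuous_logPrim.comp (by fun_prop)).sub continuous_const).div_const _
  · rw [interior_Icc]
    intro x hx x' hx' hxx'
    rw [(hderiv x hx).deriv, (hderiv x' hx').deriv, ← Real.log_div hx.1.ne' (hpos x hx).ne',
      ← Real.log_div hx'.1.ne' (hpos x' hx').ne']
    refine Real.log_lt_log (div_pos hx.1 (hpos x hx)) ?_
    rw [div_lt_div_iff₀ (hpos x hx) (hpos x' hx')]
    nlinarith

theorem sum_rateTerm_lt {β : ℝ} {c : ℤ} (hβ : 0 < β) {q : X → ℝ} (hq : ∀ i, 0 < q i)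
    (hqb : ∀ i, 0 ≤ q i + β * c) {p r : X → ℝ} (hp : ∀ i, p i ∈ Set.Icc (0 : ℝ) 1)
    (hr : ∀ i, r i ∈ Set.Icc (0 : ℝ) 1) (hne : p ≠ r)
    (hle : ∑ i, rateTerm β c (p i) (q i) ≤ ∑ i, rateTerm β c (r i) (q i)) :
    ∑ i, rateTerm β c (((1 / 2 : ℝ) • p + (1 / 2 : ℝ) • r) i) (q i) <
      ∑ i, rateTerm β c (r i) (q i) := by
  obtain ⟨i, hi⟩ := Function.ne_iff.1 hne
  have hconv := fun i => strictConvexOn_rateTerm (c := c) hβ (hq i) (hqb i)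
  have h1 : ∑ i, rateTerm β c (((1 / 2 : ℝ) • p + (1 / 2 : ℝ) • r) i) (q i) <
      ∑ i, (1 / 2 * rateTerm β c (p i) (q i) + 1 / 2 * rateTerm β c (r i) (q i)) := by
    refine Finset.sum_lt_sum (fun j _ => ?_) ⟨i, Finset.mem_univ i, ?_⟩
    · exact (hconv j).convexOn.2 (hp j) (hr j) (by norm_num) (by norm_num) (by norm_num)
    · exact (hconv i).2 (hp i) (hr i) hi (by norm_num) (by norm_num) (by norm_num)
  refine h1.trans_le ?_
  rw [Finset.sum_add_distrib, ← Finset.mul_sum, ← Finset.mul_sum]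
  linarith

theorem mem_Icc_of_mem_stdSimplex {p : X → ℝ} (hp : p ∈ stdSimplex ℝ X) (i : X) :
    p i ∈ Set.Icc (0 : ℝ) 1 :=
  ⟨hp.1 i, hp.2 ▸ Finset.single_le_sum (f := p) (fun i _ => hp.1 i) (Finset.mem_univ i)⟩

theorem add_mul_nonneg_of_mem_Icc {y b x : ℝ} (hy : 0 ≤ y) (hyb : 0 ≤ y + b)
    (hx : x ∈ Set.Icc (0 : ℝ) 1) : 0 ≤ y + b * x := by
  have h1 : y + b * x = (1 - x) * y + x * (y + b) := by ring
  rw [h1]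
  exact add_nonneg (mul_nonneg (by linarith [hx.2]) hy) (mul_nonneg hx.1 hyb)

/-- The projection on a convex set is unique if `q` is positive. -/
theorem IsProjection.unique {β : ℝ} {c : ℤ} (hβ : 0 < β) {q : X → ℝ} (hq : ∀ i, 0 < q i)
    (hqb : ∀ i, 0 ≤ q i + β * c) {S : Set (X → ℝ)} (hS : S ⊆ stdSimplex ℝ X)
    (hconv : Convex ℝ S) {p r : X → ℝ} (hp : IsProjection S β c q p)
    (hr : IsProjection S β c q r) : p = r := by
  by_contra hne
  have hfin : ∀ p, FiniteDiv c p q := fun p _ i hi => absurd hi (hq i).ne'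
  have hdiv : ∀ p ∈ S, divergence β c p q =
      ((∑ i, rateTerm β c (p i) (q i) + divConst β c : ℝ) : EReal) := fun p hp =>
    divergence_eq_coe hβ (hS hp) (fun i => (hq i).le)
      (fun i => add_mul_nonneg_of_mem_Icc (hq i).le (hqb i) (mem_Icc_of_mem_stdSimplex (hS hp) i))
      (hfin p)
  have hmid : (1 / 2 : ℝ) • p + (1 / 2 : ℝ) • r ∈ S :=
    hconv hp.1 hr.1 (by norm_num) (by norm_num) (by norm_num)
  have h1 := hp.2 r hr.1
  have h2 := hr.2 _ hmid
  rw [hdiv p hp.1, hdiv r hr.1, EReal.coe_le_coe_iff] at h1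
  rw [hdiv r hr.1, hdiv _ hmid, EReal.coe_le_coe_iff] at h2
  have h3 := sum_rateTerm_lt hβ hq hqb (mem_Icc_of_mem_stdSimplex (hS hp.1))
    (mem_Icc_of_mem_stdSimplex (hS hr.1)) hne (by linarith)
  linarith

/-! ### Limits and upper bounds of the rates along a sequence of urns. -/

/-- A sequence of urns, the `n`-th used for `n` draws, with limiting composition `q` and limiting
ratio `β` of the number of draws and the number of balls. -/
structure UrnLimit (c : ℤ) (α : ℕ → X → ℕ) (q : X → ℝ) (β : ℝ) : Prop where
  pos : ∀ n i, 0 < α n i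
  bound : ∀ (n : ℕ) (i : X), -((n : ℤ) * c) ≤ (α n i : ℤ)
  mem : q ∈ stdSimplex ℝ X
  lim : ∀ i, Tendsto (fun n => (α n i : ℝ) / (total (α n) : ℝ)) atTop (𝓝 (q i))
  ratio_pos : 0 < β
  ratio_lim : Tendsto (fun n : ℕ => (n : ℝ) / (total (α n) : ℝ)) atTop (𝓝 β)

namespace UrnLimit

variable {c : ℤ} {α : ℕ → X → ℕ} {q : X → ℝ} {β : ℝ}

theorem nonempty (U : UrnLimit c α q β) : Nonempty X := by
  by_contra h
  rw [not_nonempty_iff] at h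
  simpa using U.mem.2

theorem add_mul_nonneg (U : UrnLimit c α q β) {n k : ℕ} (hk : k ≤ n) (i : X) :
    0 ≤ (α n i : ℝ) + c * k := by
  have h1 : (0 : ℤ) ≤ (α n i : ℤ) + c * k := by
    have h2 := U.bound n i
    have hk' : (k : ℤ) ≤ n := by exact_mod_cast hk
    rcases le_total 0 c with h | h
    · positivity
    · nlinarith
  exact_mod_cast h1

theorem add_mul_pos (U : UrnLimit c α q β) {n j : ℕ} (hj : j < n) (i : X) :
    0 < (α n i : ℝ) + c * j := by
  have h1 : (0 : ℤ) < (α n i : ℤ) + c * j := by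
    have h2 := U.bound n i
    have h3 : (0 : ℤ) < α n i := by exact_mod_cast U.pos n i
    have hj' : (j : ℤ) < n := by exact_mod_cast hj
    rcases lt_or_ge c 0 with h | h
    · nlinarith
    · positivity
  exact_mod_cast h1

theorem total_pos (U : UrnLimit c α q β) (n : ℕ) : (0 : ℝ) < total (α n) := by
  obtain ⟨i⟩ := U.nonempty
  exact_mod_cast (U.pos n i).trans_le (apply_le_total (α n) i)

theorem tendsto_inv (U : UrnLimit c α q β) :
    Tendsto (fun n : ℕ => (total (α n) : ℝ) / n) atTop (𝓝 β⁻¹) :=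
  (U.ratio_lim.inv₀ U.ratio_pos.ne').congr fun n => by rw [inv_div]

theorem tendsto_total (U : UrnLimit c α q β) :
    Tendsto (fun n => (total (α n) : ℝ)) atTop atTop := by
  have h := (tendsto_natCast_atTop_atTop (R := ℝ)).atTop_mul_pos (inv_pos.2 U.ratio_pos)
    U.tendsto_inv
  refine h.congr' ?_
  filter_upwards [eventually_gt_atTop 0] with n hn
  have : (n : ℝ) ≠ 0 := by exact_mod_cast hn.ne'
  field_simp

theorem limit_add_nonneg (U : UrnLimit c α q β) (i : X) : 0 ≤ q i + β * c := by
  have h : Tendsto (fun n : ℕ => ((α n i : ℝ) + c * n) / total (α n)) atTop (𝓝 (q i + β * c)) :=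
    ((U.lim i).add (U.ratio_lim.mul_const (c : ℝ))).congr fun n => by ring
  exact ge_of_tendsto' h fun n => div_nonneg (U.add_mul_nonneg le_rfl i) (U.total_pos n).le

variable {ι : Type*} {l : Filter ι} {n : ι → ℕ}

theorem logRise_zero (a N : ℝ) (k : ℕ) : logRise a 0 N k = k * Real.log (a / N) := by
  simp [logRise]

theorem alpha_le_total (m : ℕ) (i : X) : (α m i : ℝ) ≤ total (α m) := by
  exact_mod_cast apply_le_total (α m) i

theorem one_le_alpha (U : UrnLimit c α q β) (m : ℕ) (i : X) : (1 : ℝ) ≤ α m i := by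
  exact_mod_cast U.pos m i

/-- If `c = 0` and `q i = 0`, the logarithm of `α i / N` may be as low as `-log N`, and only a
bounded number of such terms is sure to vanish after division by `n`. The limit is then `0`, in
agreement with `Real.log 0 = 0` in `riseLimit`. -/
theorem tendsto_logRise_div (U : UrnLimit c α q β) (hn : Tendsto n l atTop) {k : ι → ℕ} {i : X}
    {x : ℝ} (hk : ∀ᶠ m in l, k m ≤ n m) (hx : Tendsto (fun m => (k m : ℝ) / n m) l (𝓝 x))
    (h : c ≠ 0 ∨ q i ≠ 0 ∨ ∃ T : ℕ, ∀ᶠ m in l, k m ≤ T) :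
    Tendsto (fun m => logRise (α (n m) i) c (total (α (n m))) (k m) / n m) l
      (𝓝 (riseLimit β c x (q i))) := by
  have hN := U.tendsto_total.comp hn
  by_cases hc : c = 0
  · rw [riseLimit, if_pos hc, hc, Int.cast_zero]
    simp_rw [logRise_zero]
    by_cases hq : q i = 0
    · obtain ⟨T, hT⟩ := (h.resolve_left (not_not.2 hc)).resolve_left (not_not.2 hq)
      rw [hq, Real.log_zero, mul_zero]
      have hlog := (tendsto_log_div_atTop hN).mul (U.tendsto_inv.comp hn)
      have hbd := (hlog.const_mul (T : ℝ))
      rw [zero_mul, mul_zero] at hbd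
      refine squeeze_zero_norm' ?_ hbd
      filter_upwards [hT] with m hm
      have h1 := abs_log_div_le (U.one_le_alpha (n m) i) (alpha_le_total (n m) i)
      have h2 := (U.total_pos (n m)).ne'
      rw [Real.norm_eq_abs, abs_div, abs_mul, Nat.abs_cast, Nat.abs_cast]
      have h3 : (k m : ℝ) ≤ T := by exact_mod_cast hm
      calc (k m : ℝ) * |Real.log (α (n m) i / total (α (n m)))| / n m
          ≤ T * Real.log (total (α (n m))) / n m := by gcongr
        _ = _ := by
          simp only [Function.comp_apply]
          field_simp
    · have h1 := ((U.lim i).comp hn).log hq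
      exact (hx.mul h1).congr fun m => by simp only [Function.comp_apply]; ring
  · rw [riseLimit, if_neg hc]
    have hz : Tendsto (fun m => (k m : ℝ) / total (α (n m))) l (𝓝 (β * x)) := by
      refine ((U.ratio_lim.comp hn).mul hx).congr' ?_
      filter_upwards [hn.eventually_gt_atTop 0] with m hm
      have : (n m : ℝ) ≠ 0 := by exact_mod_cast hm.ne'
      simp only [Function.comp_apply]
      field_simp
    have h1 := tendsto_logRise (a := fun m => α (n m) i) (c := c) (by exact_mod_cast hc) hN
      (Eventually.of_forall fun m => U.pos (n m) i)
      (Eventually.of_forall fun m => alpha_le_total (n m) i)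
      (hk.mono fun m hm j hj => U.add_mul_pos (hj.trans_le hm) i)
      (hk.mono fun m hm => U.add_mul_nonneg hm i) ((U.lim i).comp hn) hz
    have h2 := h1.mul (U.tendsto_inv.comp hn)
    have e : (logPrim (q i + β * c * x) - logPrim (q i)) / (β * c) =
        (logPrim (q i + c * (β * x)) - logPrim (q i)) / c * β⁻¹ := by
      have h3 := U.ratio_pos.ne'
      rw [show q i + β * c * x = q i + c * (β * x) by ring]
      field_simp
    rw [e]
    refine h2.congr fun m => ?_
    have h2 := (U.total_pos (n m)).ne'
    simp only [Function.comp_apply]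
    field_simp

theorem logRise_div_nonpos (U : UrnLimit c α q β) (hc : c = 0) (m : ℕ) (i : X) (k : ℕ) :
    logRise (α m i) c (total (α m)) k / m ≤ 0 := by
  rw [hc, Int.cast_zero, logRise_zero]
  refine div_nonpos_of_nonpos_of_nonneg (mul_nonpos_of_nonneg_of_nonpos k.cast_nonneg ?_)
    m.cast_nonneg
  exact Real.log_nonpos (div_nonneg (Nat.cast_nonneg _) (U.total_pos m).le)
    ((div_le_one (U.total_pos m)).2 (alpha_le_total m i))

variable {k : ι → X → ℕ} {p : X → ℝ}

theorem tendsto_rate (U : UrnLimit c α q β) (hn : Tendsto n l atTop)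
    (hk : ∀ᶠ m in l, ∀ i, k m i ≤ n m)
    (hx : ∀ i, Tendsto (fun m => (k m i : ℝ) / n m) l (𝓝 (p i)))
    (h : ∀ i, c ≠ 0 ∨ q i ≠ 0 ∨ ∃ T : ℕ, ∀ᶠ m in l, k m i ≤ T) :
    Tendsto (fun m => rate (α (n m)) c (n m) (k m)) l (𝓝 (-∑ i, rateTerm β c (p i) (q i))) := by
  rw [← Finset.sum_neg_distrib]
  refine tendsto_finsetSum _ fun i _ => ?_
  rw [rateTerm, neg_sub]
  exact (U.tendsto_logRise_div hn (hk.mono fun m hm => hm i) (hx i) (h i)).sub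
    (tendsto_logRise_one hn (hx i))

/-- Competing types need only an upper bound, so no control of the number of draws of vanishing
colours is required: for `c = 0` their contributions are nonpositive and can be dropped. -/
theorem eventually_rate_lt (U : UrnLimit c α q β) (hn : Tendsto n l atTop)
    (hk : ∀ᶠ m in l, ∀ i, k m i ≤ n m)
    (hx : ∀ i, Tendsto (fun m => (k m i : ℝ) / n m) l (𝓝 (p i))) (hp : ∀ i, 0 ≤ p i) {v : ℝ}
    (hv : FiniteDiv c p q → -∑ i, rateTerm β c (p i) (q i) < v) :
    ∀ᶠ m in l, rate (α (n m)) c (n m) (k m) < v := by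
  by_cases hc : c = 0
  · by_cases hfin : FiniteDiv c p q
    · have h1 : Tendsto (fun m => ∑ i, ((if q i = 0 then 0 else
          logRise (α (n m) i) c (total (α (n m))) (k m i) / n m) -
            logRise 1 1 (n m) (k m i) / n m)) l (𝓝 (-∑ i, rateTerm β c (p i) (q i))) := by
        rw [← Finset.sum_neg_distrib]
        refine tendsto_finsetSum _ fun i _ => ?_
        rw [rateTerm, neg_sub]
        refine Tendsto.sub ?_ (tendsto_logRise_one hn (hx i))
        split_ifs with hq
        · simpa [riseLimit, hc, hq] using tendsto_const_nhds
        · exact U.tendsto_logRise_div hn (hk.mono fun m hm => hm i) (hx i) (Or.inr (Or.inl hq))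
      filter_upwards [h1.eventually_lt_const (hv hfin)] with m hm
      refine lt_of_le_of_lt (Finset.sum_le_sum fun i _ => ?_) hm
      refine sub_le_sub_right ?_ _
      split_ifs
      · exact U.logRise_div_nonpos hc _ _ _
      · exact le_rfl
    -- Infinite divergence: a positive fraction of the draws has a colour with `α i / N → 0`, so the
    -- rate tends to `-∞`.
    · unfold FiniteDiv at hfin
      push Not at hfin
      obtain ⟨-, i, hq, hpi⟩ := hfin
      have hpi : 0 < p i := lt_of_le_of_ne (hp i) (Ne.symm hpi)
      have h1 : Tendsto (fun m => ∑ i, logRise 1 1 (n m) (k m i) / n m) l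
          (𝓝 (∑ i, logPrim (p i))) :=
        tendsto_finsetSum _ fun i _ => tendsto_logRise_one hn (hx i)
      have h2 : Tendsto (fun m => logRise (α (n m) i) c (total (α (n m))) (k m i) / n m) l
          atBot := by
        have h3 : Tendsto (fun m => (α (n m) i : ℝ) / total (α (n m))) l (𝓝[≠] 0) := by
          refine tendsto_nhdsWithin_iff.2 ⟨?_, Eventually.of_forall fun m => ?_⟩
          · have := (U.lim i).comp hn
            rwa [hq] at this
          · have h4 := U.one_le_alpha (n m) i
            exact (div_pos (by linarith) (U.total_pos _)).ne'
        have h5 := (hx i).pos_mul_atBot hpi (Real.tendsto_log_nhdsNE_zero.comp h3)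
        refine h5.congr fun m => ?_
        rw [hc, Int.cast_zero, logRise_zero, Function.comp_apply]
        ring
      have h6 : Tendsto (fun m => logRise (α (n m) i) c (total (α (n m))) (k m i) / n m -
          ∑ i, logRise 1 1 (n m) (k m i) / n m) l atBot := by
        simp_rw [sub_eq_add_neg]
        exact h2.atBot_add h1.neg
      filter_upwards [h6.eventually_lt_atBot v] with m hm
      refine lt_of_le_of_lt ?_ hm
      rw [rate, Finset.sum_sub_distrib]
      refine sub_le_sub_right ?_ _
      classical
      rw [← Finset.add_sum_erase _ _ (Finset.mem_univ i)]
      have := Finset.sum_nonpos (s := Finset.univ.erase i)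
        fun j _ => U.logRise_div_nonpos hc (n m) j (k m j)
      linarith
  · exact (U.tendsto_rate hn hk hx fun i => Or.inl hc).eventually_lt_const
      (hv fun h => absurd h hc)

end UrnLimit

/-! ### Draws without replacement in the limit. -/

theorem tendsto_natSub_div {ι : Type*} {l : Filter ι} {n k : ι → ℕ} {x : ℝ}
    (hn : Tendsto n l atTop) (hx : Tendsto (fun m => (k m : ℝ) / n m) l (𝓝 x)) (r : ℕ) :
    Tendsto (fun m => ((k m - r : ℕ) : ℝ) / n m) l (𝓝 x) := by
  have h1 : Tendsto (fun m => (k m : ℝ) / n m - r / n m) l (𝓝 x) := by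
    simpa using hx.sub ((tendsto_natCast_atTop_atTop.comp hn).const_div_atTop (r : ℝ))
  refine tendsto_of_tendsto_of_tendsto_of_le_of_le h1 hx (fun m => ?_) (fun m => ?_)
  · simp only
    rw [← sub_div]
    gcongr
    rw [sub_le_iff_le_add]
    exact_mod_cast (by omega : k m ≤ k m - r + r)
  · simp only
    gcongr
    exact Nat.sub_le _ _

theorem tendsto_descFactorial_div_pow {ι : Type*} {l : Filter ι} {n k : ι → ℕ} {x : ℝ}
    (hn : Tendsto n l atTop) (hx : Tendsto (fun m => (k m : ℝ) / n m) l (𝓝 x)) (r : ℕ) :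
    Tendsto (fun m => ((k m).descFactorial r : ℝ) / (n m : ℝ) ^ r) l (𝓝 (x ^ r)) := by
  induction r with
  | zero => simpa using tendsto_const_nhds
  | succ r ih =>
    rw [pow_succ']
    refine ((tendsto_natSub_div hn hx r).mul ih).congr fun m => ?_
    rw [Nat.descFactorial_succ, pow_succ']
    push_cast
    rw [div_mul_div_comm]

theorem prod_pow_count {t : ℕ} (x : Fin t → X) (f : X → ℝ) :
    ∏ i, f i ^ count x i = ∏ l, f (x l) := by
  classical
  rw [← Finset.prod_fiberwise' Finset.univ x f]
  refine Finset.prod_congr rfl fun i _ => ?_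
  rw [Finset.prod_const, count]

theorem tendsto_prefixRatio {ι : Type*} {l : Filter ι} {n : ι → ℕ} {k : ι → X → ℕ} {p : X → ℝ}
    (hn : Tendsto n l atTop) (hx : ∀ i, Tendsto (fun m => (k m i : ℝ) / n m) l (𝓝 (p i)))
    {t : ℕ} (x : Fin t → X) :
    Tendsto (fun m => prefixRatio (n m) x (k m)) l (𝓝 (∏ l, p (x l))) := by
  have hn0 : ∀ᶠ m in l, (n m : ℝ) ≠ 0 :=
    (hn.eventually_gt_atTop 0).mono fun m hm => by exact_mod_cast hm.ne'
  have h1 : Tendsto (fun m => ((n m).descFactorial t : ℝ) / (n m : ℝ) ^ t) l (𝓝 1) := by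
    have := tendsto_descFactorial_div_pow (k := n) (x := 1) hn
      (tendsto_const_nhds.congr' (hn0.mono fun m hm => (div_self hm).symm)) t
    rwa [one_pow] at this
  have h2 := (tendsto_finsetProd Finset.univ fun i _ =>
    tendsto_descFactorial_div_pow hn (hx i) (count x i)).div h1 one_ne_zero
  rw [div_one, prod_pow_count] at h2
  refine h2.congr' (hn0.mono fun m hm => ?_)
  simp only [Pi.div_apply]
  rw [Finset.prod_div_distrib, Finset.prod_pow_eq_pow_sum, sum_count, prefixRatio]
  exact div_div_div_cancel_right₀ (pow_ne_zero _ hm) _ _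

/-! ### Uniformity over types, and the gap in the rates. -/

/-- The filter of pairs of a number of draws `n` along `l` and a vector of counts of `n` draws
whose type tends to `p`. -/
def pairFilter (l : Filter ℕ) (p : X → ℝ) : Filter (ℕ × (X → ℕ)) :=
  (comap Prod.fst l ⊓ comap (fun m i => (m.2 i : ℝ) / m.1) (𝓝 p)) ⊓ 𝓟 {m | ∑ i, m.2 i = m.1}

theorem tendsto_fst_pairFilter (l : Filter ℕ) (p : X → ℝ) :
    Tendsto Prod.fst (pairFilter l p) l :=
  tendsto_comap.mono_left (inf_le_left.trans inf_le_left)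

theorem tendsto_type_pairFilter (l : Filter ℕ) (p : X → ℝ) (i : X) :
    Tendsto (fun m : ℕ × (X → ℕ) => (m.2 i : ℝ) / m.1) (pairFilter l p) (𝓝 (p i)) := by
  have h : Tendsto (fun (m : ℕ × (X → ℕ)) i => (m.2 i : ℝ) / m.1) (pairFilter l p) (𝓝 p) :=
    tendsto_comap.mono_left (inf_le_left.trans inf_le_right)
  exact tendsto_pi_nhds.1 h i

theorem eventually_le_pairFilter (l : Filter ℕ) (p : X → ℝ) :
    ∀ᶠ m in pairFilter l p, ∀ i, m.2 i ≤ m.1 := by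
  have h : ∀ᶠ m in pairFilter l p, ∑ i, m.2 i = m.1 :=
    mem_inf_of_right (mem_principal_self _)
  filter_upwards [h] with m hm i
  rw [← hm]
  exact Finset.single_le_sum (f := m.2) (fun _ _ => Nat.zero_le _) (Finset.mem_univ i)

/-- Turns a limit along pairs `(n, k)` into a bound uniform over all types in one neighbourhood of
`p`, as the compactness argument requires. -/
theorem exists_nhds_of_eventually_pairFilter {l : Filter ℕ} {p : X → ℝ}
    {P : ℕ → (X → ℕ) → Prop} (h : ∀ᶠ m in pairFilter l p, P m.1 m.2) :
    ∃ V ∈ 𝓝 p, ∀ᶠ n in l, ∀ k : X → ℕ, ∑ i, k i = n →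
      (fun i => (k i : ℝ) / n) ∈ V → P n k := by
  rw [pairFilter, eventually_inf_principal] at h
  obtain ⟨s, ⟨s', hs', hs⟩, u, ⟨V, hV, hu⟩, hsu⟩ := mem_inf_iff_superset.1 h
  refine ⟨V, hV, ?_⟩
  filter_upwards [hs'] with n hn k hk hkV
  exact hsu (⟨hs (show ((n, k) : ℕ × (X → ℕ)).1 ∈ s' from hn),
    hu (show (fun i => (((n, k) : ℕ × (X → ℕ)).2 i : ℝ) / ((n, k) : ℕ × (X → ℕ)).1) ∈ V
      from hkV)⟩ : (n, k) ∈ s ∩ u) hk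

/-- Each point of `K` has a neighbourhood with its own gap; by compactness finitely many suffice,
and the least gap works. -/
theorem UrnLimit.exists_gap {c : ℤ} {α : ℕ → X → ℕ} {q : X → ℝ} {β : ℝ}
    (U : UrnLimit c α q β) {l : Filter ℕ} (hl : l ≤ atTop) {R : ℕ → ℝ} {r : ℝ}
    (hR : Tendsto R l (𝓝 r)) {K : Set (X → ℝ)} (hK : IsCompact K) (hK0 : ∀ p ∈ K, ∀ i, 0 ≤ p i)
    (hKr : ∀ p ∈ K, FiniteDiv c p q → -∑ i, rateTerm β c (p i) (q i) < r) :
    ∃ δ > 0, ∀ᶠ n in l, ∀ k : X → ℕ, ∑ i, k i = n → (fun i => (k i : ℝ) / n) ∈ K →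
      rate (α n) c n k ≤ R n - δ := by
  refine hK.induction_on (p := fun K => ∃ δ > 0, ∀ᶠ n in l, ∀ k : X → ℕ, ∑ i, k i = n →
    (fun i => (k i : ℝ) / n) ∈ K → rate (α n) c n k ≤ R n - δ) ?_ ?_ ?_ ?_
  · exact ⟨1, one_pos, Eventually.of_forall fun n k _ h => absurd h (Set.notMem_empty _)⟩
  · rintro s t hst ⟨δ, hδ, h⟩
    exact ⟨δ, hδ, h.mono fun n hn k hk hks => hn k hk (hst hks)⟩
  · rintro s t ⟨δ, hδ, h⟩ ⟨δ', hδ', h'⟩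
    refine ⟨min δ δ', lt_min hδ hδ', ?_⟩
    filter_upwards [h, h'] with n hn hn' k hk hkst
    rcases hkst with hks | hkt
    · exact (hn k hk hks).trans (by linarith [min_le_left δ δ'])
    · exact (hn' k hk hkt).trans (by linarith [min_le_right δ δ'])
  · intro p hp
    -- Of the margin `2 * δ`, one `δ` absorbs the difference between `R n` and `r`; the other is the
    -- gap.
    obtain ⟨δ, hδ, hv⟩ : ∃ δ > 0, FiniteDiv c p q →
        -∑ i, rateTerm β c (p i) (q i) < r - 2 * δ := by
      by_cases hfin : FiniteDiv c p q
      · have := hKr p hp hfin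
        exact ⟨(r - -∑ i, rateTerm β c (p i) (q i)) / 3, by linarith, fun _ => by linarith⟩
      · exact ⟨1, one_pos, fun h => absurd h hfin⟩
    have h1 := U.eventually_rate_lt ((tendsto_fst_pairFilter l p).mono_right hl)
      (eventually_le_pairFilter l p) (tendsto_type_pairFilter l p) (hK0 p hp) hv
    have h2 := ((hR.comp (tendsto_fst_pairFilter l p)).eventually_const_lt
      (show r - δ < r by linarith))
    obtain ⟨V, hV, h⟩ := exists_nhds_of_eventually_pairFilter
      (P := fun n k => rate (α n) c n k ≤ R n - δ) (by
        filter_upwards [h1, h2] with m hm hm'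
        simp only [Function.comp_apply] at hm'
        linarith)
    exact ⟨V, mem_nhdsWithin_of_mem_nhds hV, δ, hδ, h⟩

/-! ### Concentration of the conditional law. -/

theorem tendsto_pow_mul_exp_neg (d : ℕ) {δ : ℝ} (hδ : 0 < δ) :
    Tendsto (fun n : ℕ => ((n : ℝ) + 1) ^ d * Real.exp (-(n * δ))) atTop (𝓝 0) := by
  have h1 : |Real.exp (-δ)| < 1 := by
    rw [abs_of_pos (Real.exp_pos _), Real.exp_lt_one_iff]
    linarith
  have h2 := ((tendsto_pow_const_mul_const_pow_of_abs_lt_one d h1).comp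
    (tendsto_add_atTop_nat 1)).mul_const (Real.exp δ)
  rw [zero_mul] at h2
  refine h2.congr fun n => ?_
  simp only [Function.comp_apply]
  rw [← Real.exp_nat_mul, mul_assoc, ← Real.exp_add]
  push_cast
  congr 2
  ring

/-- Near indices err by at most `ε`. Each far index has weight at most `η` times that of the single
index `j`, hence at most `η` times the total weight. -/
theorem abs_weighted_average_sub_le {ι : Type*} {s : Finset ι} {w f : ι → ℝ} {a ε η : ℝ}
    (near : ι → Prop) {j : ι} (hj : j ∈ s) (hw : ∀ i ∈ s, 0 < w i)
    (hf : ∀ i ∈ s, |f i - a| ≤ 1) (hε : 0 ≤ ε) (hη : 0 ≤ η)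
    (hnear : ∀ i ∈ s, near i → |f i - a| ≤ ε) (hfar : ∀ i ∈ s, ¬ near i → w i ≤ η * w j) :
    |(∑ i ∈ s, w i * f i) / (∑ i ∈ s, w i) - a| ≤ ε + s.card * η := by
  have hpos : 0 < ∑ i ∈ s, w i := Finset.sum_pos hw ⟨j, hj⟩
  have h1 : (∑ i ∈ s, w i * f i) / (∑ i ∈ s, w i) - a =
      (∑ i ∈ s, w i * (f i - a)) / ∑ i ∈ s, w i := by
    simp_rw [mul_sub]
    rw [Finset.sum_sub_distrib, ← Finset.sum_mul]
    field_simp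
  rw [h1, abs_div, abs_of_pos hpos, div_le_iff₀ hpos]
  calc |∑ i ∈ s, w i * (f i - a)| ≤ ∑ i ∈ s, |w i * (f i - a)| := Finset.abs_sum_le_sum_abs _ _
    _ ≤ ∑ i ∈ s, (ε * w i + η * w j) := by
        refine Finset.sum_le_sum fun i hi => ?_
        rw [abs_mul, abs_of_pos (hw i hi)]
        by_cases h : near i
        · have h2 := mul_le_mul_of_nonneg_left (hnear i hi h) (hw i hi).le
          have h3 := mul_nonneg hη (hw j hj).le
          linarith
        · have h2 := mul_le_mul_of_nonneg_left (hf i hi) (hw i hi).le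
          have h3 := mul_nonneg hε (hw i hi).le
          linarith [hfar i hi h]
    _ = ε * ∑ i ∈ s, w i + s.card * η * w j := by
        rw [Finset.sum_add_distrib, ← Finset.mul_sum, Finset.sum_const, nsmul_eq_mul]
        ring
    _ ≤ (ε + s.card * η) * ∑ i ∈ s, w i := by
        have h2 := Finset.single_le_sum (f := w) (fun i hi => (hw i hi).le) hj
        have h3 : (0 : ℝ) ≤ s.card * η := by positivity
        nlinarith [mul_le_mul_of_nonneg_left h2 h3]

/-- Conditional limit theorem, from a bound on the types that are not near `p`. -/
theorem UrnLimit.tendsto_condProb {c : ℤ} {α : ℕ → X → ℕ} {q : X → ℝ} {β : ℝ}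
    (U : UrnLimit c α q β) {l : Filter ℕ} (hl : l ≤ atTop) {S : Set (X → ℝ)}
    (hS : IsCompact S) {p : X → ℝ} (hp : p ∈ stdSimplex ℝ X) {k' : ℕ → X → ℕ}
    (hk' : ∀ᶠ n in l, k' n ∈ typeVecs n S)
    (hgap : ∀ K ⊆ S, IsCompact K → p ∉ K → ∃ δ > 0, ∀ᶠ n in l, ∀ k : X → ℕ, ∑ i, k i = n →
      (fun i => (k i : ℝ) / n) ∈ K → rate (α n) c n k ≤ rate (α n) c n (k' n) - δ)
    {t : ℕ} (x : Fin t → X) :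
    Tendsto (fun n => condProb (α n) c (prefixEvent n x) (typeEvent n S)) l
      (𝓝 (∏ l, p (x l))) := by
  have := U.nonempty
  have hprod0 : 0 ≤ ∏ l, p (x l) := Finset.prod_nonneg fun l _ => hp.1 _
  have hprod1 : ∏ l, p (x l) ≤ 1 :=
    Finset.prod_le_one (fun l _ => hp.1 _) fun l _ => (mem_Icc_of_mem_stdSimplex hp _).2
  rw [Metric.tendsto_nhds]
  intro ε hε
  have h1 := (tendsto_prefixRatio ((tendsto_fst_pairFilter l p).mono_right hl)
    (tendsto_type_pairFilter l p) x).eventually (Metric.closedBall_mem_nhds _ (half_pos hε))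
  obtain ⟨V, hV, hnear⟩ := exists_nhds_of_eventually_pairFilter
    (P := fun n k => prefixRatio n x k ∈ Metric.closedBall (∏ l, p (x l)) (ε / 2)) h1
  obtain ⟨δ, hδ, hfar⟩ := hgap (S \ interior V) Set.sdiff_subset (hS.diff isOpen_interior)
    fun h => h.2 (mem_interior_iff_mem_nhds.2 hV)
  have hsmall := ((tendsto_pow_mul_exp_neg (Fintype.card X) hδ).mono_left hl).eventually_lt_const
    (half_pos hε)
  filter_upwards [hk', hnear, hfar, hsmall, hl (eventually_ge_atTop t),
    hl (eventually_gt_atTop 0)] with n hk' hnear hfar hsmall ht hn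
  have hpos : ∀ i, ∀ j < n, 0 < (α n i : ℝ) + c * j := fun i j hj => U.add_mul_pos hj i
  rw [condProb_eq ht hpos, Real.dist_eq]
  have hmain := abs_weighted_average_sub_le (s := typeVecs n S) (w := typeWeight (α n) c)
    (f := prefixRatio n x) (a := ∏ l, p (x l)) (ε := ε / 2) (η := Real.exp (-(n * δ)))
    (fun k => (fun i => (k i : ℝ) / n) ∈ interior V) hk'
    (fun k hk => typeWeight_pos hpos (mem_typeVecs.1 hk).1)
    (fun k hk => by
      have h2 := prefixRatio_nonneg n x k
      have h3 := prefixRatio_le_one ht x (mem_typeVecs.1 hk).1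
      rw [abs_le]
      constructor <;> linarith)
    (half_pos hε).le (Real.exp_pos _).le
    (fun k hk hkV => by
      have := hnear k (mem_typeVecs.1 hk).1 (interior_subset hkV)
      rwa [Metric.mem_closedBall, Real.dist_eq] at this)
    (fun k hk hkV => by
      have h2 := hfar k (mem_typeVecs.1 hk).1 ⟨(mem_typeVecs.1 hk).2, hkV⟩
      have hN := U.total_pos n
      have hn' : (0 : ℝ) < n := by exact_mod_cast hn
      rw [typeWeight_eq_exp hn hpos (mem_typeVecs.1 hk).1,
        typeWeight_eq_exp hn hpos (mem_typeVecs.1 hk').1, mul_left_comm, ← Real.exp_add]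
      gcongr
      nlinarith)
  refine hmain.trans_lt ?_
  have hcard : ((typeVecs n S).card : ℝ) ≤ ((n : ℝ) + 1) ^ Fintype.card X := by
    exact_mod_cast card_typeVecs_le n S
  have := mul_le_mul_of_nonneg_right hcard (Real.exp_pos (-(n * δ))).le
  linarith

theorem UrnLimit.conditional_limit {c : ℤ} {α : ℕ → X → ℕ} {q : X → ℝ} {β : ℝ}
    (U : UrnLimit c α q β) {S : Set (X → ℝ)} (hS : S ⊆ stdSimplex ℝ X) (hconv : Convex ℝ S)
    (hclosed : IsClosed S) {p : X → ℝ} (hproj : IsProjection S β c q p)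
    (huniq : ∀ r, IsProjection S β c q r → r = p)
    (htypes : p ∈ closure (⋃ n : ℕ, typesIn n S)) {t : ℕ} (x : Fin t → X) :
    Tendsto (fun n => condProb (α n) c (prefixEvent n x) (typeEvent n S))
      (atTop ⊓ 𝓟 {n | (typeVecs n S).Nonempty}) (𝓝 (∏ l, p (x l))) := by
  have hcompact : IsCompact S := (isCompact_stdSimplex ℝ X).of_isClosed_subset hclosed hS
  obtain ⟨T, hT⟩ := exists_typeVecs_near hS hconv hproj.1 htypes
  have hT' : ∀ n, ∃ k : X → ℕ, T ≤ n → (typeVecs n S).Nonempty →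
      k ∈ typeVecs n S ∧ ∀ i, |(k i : ℝ) - n * p i| ≤ T := by
    intro n
    by_cases h : T ≤ n ∧ (typeVecs n S).Nonempty
    · obtain ⟨k, hk⟩ := hT n h.1 h.2
      exact ⟨k, fun _ _ => hk⟩
    · exact ⟨0, fun h1 h2 => absurd ⟨h1, h2⟩ h⟩
  choose k' hk' using hT'
  set l : Filter ℕ := atTop ⊓ 𝓟 {n | (typeVecs n S).Nonempty}
  have hl : l ≤ atTop := inf_le_left
  have hlk : ∀ᶠ n in l, k' n ∈ typeVecs n S ∧ ∀ i, |(k' n i : ℝ) - n * p i| ≤ T := by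
    filter_upwards [hl (eventually_ge_atTop T), mem_inf_of_right (mem_principal_self _)]
      with n h1 h2
    exact hk' n h1 h2
  have hstrict : ∀ r ∈ S, r ≠ p → ¬ divergence β c r q ≤ divergence β c p q :=
    fun r hr hne hle => hne (huniq r ⟨hr, fun s hs => hle.trans (hproj.2 s hs)⟩)
  refine U.tendsto_condProb hl hcompact (hS hproj.1) (hlk.mono fun n h => h.1)
    (fun K hKS hK hpK => ?_) x
  have hKne : ∀ r ∈ K, r ≠ p := fun r hr h => hpK (h ▸ hr)
  -- If the projection has finite divergence, every other point of `S` has a strictly larger one by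
  -- uniqueness, which gives the strict inequality of rates.
  by_cases hfin : FiniteDiv c p q
  · have hcoe : ∀ r ∈ S, FiniteDiv c r q → divergence β c r q =
        ((∑ i, rateTerm β c (r i) (q i) + divConst β c : ℝ) : EReal) := fun r hr hfin =>
      divergence_eq_coe U.ratio_pos (hS hr) U.mem.1 (fun i => add_mul_nonneg_of_mem_Icc (U.mem.1 i)
        (U.limit_add_nonneg i) (mem_Icc_of_mem_stdSimplex (hS hr) i)) hfin
    have hlim : ∀ i, Tendsto (fun n => (k' n i : ℝ) / n) l (𝓝 (p i)) := by
      intro i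
      rw [tendsto_iff_norm_sub_tendsto_zero]
      refine squeeze_zero' (Eventually.of_forall fun n => norm_nonneg _) ?_
        ((tendsto_const_div_atTop_nhds_zero_nat (T : ℝ)).mono_left hl)
      filter_upwards [hlk, hl (eventually_gt_atTop 0)] with n hn hn0
      have hn0 : (0 : ℝ) < n := by exact_mod_cast hn0
      rw [Real.norm_eq_abs, le_div_iff₀ hn0, ← abs_of_pos hn0, ← abs_mul, abs_of_pos hn0, sub_mul,
        div_mul_cancel₀ _ hn0.ne', mul_comm (p i)]
      exact hn.2 i
    refine U.exists_gap hl (U.tendsto_rate (n := id) (tendsto_id.mono_left hl)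
      (hlk.mono fun n hn i => ?_) hlim fun i => ?_) hK (fun r hr => (hS (hKS hr)).1)
      fun r hr hr_fin => ?_
    · exact (Finset.single_le_sum (f := k' n) (fun _ _ => Nat.zero_le _)
        (Finset.mem_univ i)).trans_eq (mem_typeVecs.1 hn.1).1
    -- For `c = 0` and `q i = 0`, finiteness gives `p i = 0`, so the `O(1 / n)` distance of the
    -- reference type bounds `k' n i` by `T`.
    · by_cases hc : c = 0
      · by_cases hq : q i = 0
        · refine Or.inr (Or.inr ⟨T, hlk.mono fun n hn => ?_⟩)
          have h1 := hn.2 i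
          rw [hfin hc i hq, mul_zero, sub_zero, Nat.abs_cast] at h1
          exact_mod_cast h1
        · exact Or.inr (Or.inl hq)
      · exact Or.inl hc
    · have h1 := hstrict r (hKS hr) (hKne r hr)
      rw [hcoe r (hKS hr) hr_fin, hcoe p hproj.1 hfin, EReal.coe_le_coe_iff] at h1
      linarith
  -- If the minimum is `⊤`, every point of `S` is a minimizer, so uniqueness leaves only `p` in `S`
  -- and there are no far types.
  · have hK0 : K = ∅ := Set.eq_empty_of_forall_notMem fun r hr =>
      hstrict r (hKS hr) (hKne r hr) (by rw [divergence_eq_top hfin]; exact le_top)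
    exact ⟨1, one_pos, Eventually.of_forall fun n k _ h => by simp [hK0] at h⟩

end Polya

end

theorem theorem3 {X : Type*} [Fintype X]
    (c : ℤ) (α : ℕ → X → ℕ)
    (hα : ∀ n i, 0 < α n i)
    (hc : ∀ (n : ℕ) (i : X), -((n : ℤ) * c) ≤ (α n i : ℤ))
    (q : X → ℝ) (hq : q ∈ stdSimplex ℝ X)
    (hqlim : ∀ i, Tendsto (fun n => (α n i : ℝ) / (Polya.total (α n) : ℝ)) atTop (𝓝 (q i)))
    (β : ℝ) (hβ0 : 0 < β) (hβ1 : β < 1)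
    (hβlim : Tendsto (fun n : ℕ => (n : ℝ) / (Polya.total (α n) : ℝ)) atTop (𝓝 β))
    (S : Set (X → ℝ)) (hS : S ⊆ stdSimplex ℝ X) (hconv : Convex ℝ S) (hclosed : IsClosed S)
    (phat : X → ℝ) (hproj : Polya.IsProjection S β c q phat)
    -- if the limit composition `q` has a zero entry, the projection has to be unique
    (huniq : (∀ i, 0 < q i) ∨ ∀ p, Polya.IsProjection S β c q p → p = phat)
    -- the projection is a limit of types that lie in `S`
    (htypes : phat ∈ closure (⋃ n : ℕ, Polya.typesIn n S))
    (t : ℕ) (x : Fin t → X) :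
    (∃ᶠ n in atTop, 0 < Polya.prob (α n) c (Polya.typeEvent n S)) ∧
    Tendsto
      (fun n => Polya.condProb (α n) c (Polya.prefixEvent n x) (Polya.typeEvent n S))
      (atTop ⊓ 𝓟 {n | 0 < Polya.prob (α n) c (Polya.typeEvent n S)})
      (𝓝 (∏ l, phat (x l))) := by
  have U : Polya.UrnLimit c α q β := ⟨hα, hc, hq, hqlim, hβ0, hβlim⟩
  have := U.nonempty
  have hiff : ∀ n, 0 < Polya.prob (α n) c (Polya.typeEvent n S) ↔ (Polya.typeVecs n S).Nonempty :=
    fun n => Polya.prob_typeEvent_pos_iff fun i j hj => U.add_mul_pos hj i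
  have huniq' : ∀ r, Polya.IsProjection S β c q r → r = phat := by
    rcases huniq with h | h
    · exact fun r hr => hr.unique hβ0 h U.limit_add_nonneg hS hconv hproj
    · exact h
  simp_rw [hiff]
  exact ⟨Polya.frequently_typeVecs_nonempty hS (closure_nonempty_iff.1 ⟨_, htypes⟩),
    U.conditional_limit hS hconv hclosed hproj huniq' htypes x⟩
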